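/- **Setting.** Let $d\ge 1$, $0<\rho<1$, $\mathfrak c_0>0$. Let $c_1,\dots,c_d:\{0,1\}^{\mathbb Z^d}\to\mathbb R$ be cylinder functions (depending on finitely many coordinates) with $c_j\ge \mathfrak c_0$, such that $c_j$ does not depend on $\eta_0,\eta_{e_j}$, and such that there are cylinder functions $h_{j,k}$ with $c_j(\eta)[\eta_{e_j}-\eta_0]=\sum_{k=1}^d\{h_{j,k}(\tau_{e_k}\eta)-h_{j,k}(\eta)\}$, where $(\tau_x\eta)_z=\eta_{x+z}$. Let $(a_n)_{n\ge1}$ be positive numbers with $a_n\to\infty$ and $a_n/n^2\to0$. On $\Omega_n=\{0,1\}^{\mathbb T^d_n}$, $\mathbb T^d_n=(\mathbb Z/n\mathbb Z)^d$, let $S^n(t)=e^{tL_n}$ be the semigroup of the Markov chain with generator $L_n=n^2L_n^S+a_nL_n^V$, where $$(L_n^Sf)(\eta)=\sum_{x}\sum_{j=1}^d c_j(\tau_x\eta)\{f(\sigma^{x,x+e_j}\eta)-f(\eta)\},\qquad (L_n^Vf)(\eta)=\sum_{x}\sum_{y\sim x}(\eta_y-\eta_x)^2\{f(\sigma^x\eta)-f(\eta)\}.$$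 Here $\sigma^{x,y}$ exchanges the values at $x,y$, $\sigma^x$ flips the value at $x$, $y\sim x$ means that $x,y$ are nearest neighbours, and $c_j(\tau_x\eta)$ is evaluated with coordinates read modulo $n$. Let $\nu^n_\rho$ be the Bernoulli($\rho$) product measure on $\Omega_n$ and $H(\mu|\nu)=\sup_f\{\int f\,d\mu-\log\int e^f\,d\nu\}$ the relative entropy. For a probability measure $\mu_n$ on $\Omega_n$ put $H_n(t)=H(\mu_nS^n(t)\,|\,\nu^n_\rho)$, and let $$R_d(n)=\sqrt{a_n}\ (d=1),\qquad a_n\log n\ (d=2),\qquad a_n n^{d-2}\ (d\ge3).$$ **Theorem.** There is a finite constant $C_0>0$ depending only on $\rho$, $d$ and $\mathfrak c_0$ such that, for all rates $(c_j)$ and sequences $(a_n)$ as above, there is $n_0$ (depending on them) such that for every $n\ge n_0$ and every probability measure $\mu_n$ on $\Omega_n$: 1. $H_n$ is differentiable at every $t>0$, and $H_n'(t)\le C_0\,a_n\{H_n(t)+R_d(n)\}$; 2. the right derivative of $H_n$ at $t=0$ exists in $[-\infty,\infty)$ and satisfies the same inequality at $t=0$; 3. $H_n(t)\le\{H_n(0)+R_d(n)\}\,e^{C_0a_nt}$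 for all $t\ge0$. Moreover, for all such $(c_j)$ and $(a_n)$ there is a finite constant $C_1>0$, depending on $\rho$, $d$, $(c_j)$ and $(a_n)$ but not on $n$, $\mu_n$ or $t$, such that 1.–3. hold with $C_1$ in place of $C_0$ for every $n\ge1$ and every probability measure $\mu_n$ on $\Omega_n$. -/

import Mathlib

open MeasureTheory Filter Topology

noncomputable section

namespace VoterStirring

/-- Configurations on the infinite lattice: `{0,1}^(ℤ^d)`, with opinion `1` encoded by `true`. -/
abbrev LatticeConfig (d : ℕ) := (Fin d → ℤ) → Bool

/-- The discrete torus `(ℤ/nℤ)^d`. -/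
abbrev Torus (d n : ℕ) := Fin d → ZMod n

/-- The state space `{0,1}^((ℤ/nℤ)^d)`. -/
abbrev Config (d n : ℕ) := Torus d n → Bool

/-- The numerical value `0` or `1` of an opinion. -/
def occ (b : Bool) : ℝ := if b then 1 else 0

/-- The translation `(τ_x η)_z = η_{x+z}` on lattice configurations. -/
def shift {d : ℕ} (x : Fin d → ℤ) (η : LatticeConfig d) : LatticeConfig d :=
  fun z => η (x + z)

/-- A cylinder function: it depends on finitely many coordinates only. -/
def IsCylinder {d : ℕ} (g : LatticeConfig d → ℝ) : Prop :=
  ∃ A : Finset (Fin d → ℤ), DependsOn g (A : Set (Fin d → ℤ))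

/-- The standing assumptions on the exchange rates `c_1, …, c_d`: they are cylinder functions
bounded below by `c₀`, `c_j` does not depend on the coordinates `0` and `e_j`, and the gradient
condition holds. -/
structure IsGradientRates {d : ℕ} (c₀ : ℝ) (c : Fin d → LatticeConfig d → ℝ) : Prop where
  cylinder : ∀ j, IsCylinder (c j)
  lower : ∀ j η, c₀ ≤ c j η
  indep : ∀ j, DependsOn (c j) ({0, Pi.single j 1}ᶜ : Set (Fin d → ℤ))
  gradient : ∀ j, ∃ h : Fin d → LatticeConfig d → ℝ, (∀ k, IsCylinder (h k)) ∧
    ∀ η, c j η * (occ (η (Pi.single j 1)) - occ (η 0)) =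
      ∑ k, (h k (shift (Pi.single k 1) η) - h k η)

/-- The translate `τ_x η` of a torus configuration, read modulo `n` as a lattice configuration,
so that cylinder functions can be evaluated at it. -/
def torusShift {d n : ℕ} (x : Torus d n) (η : Config d n) : LatticeConfig d :=
  fun z => η (x + fun i => (z i : ZMod n))

/-- The configuration `σ^x η`, in which the opinion at `x` is flipped. -/
def flip {d n : ℕ} (x : Torus d n) (η : Config d n) : Config d n :=
  Function.update η x (!η x)

/-- The configuration `σ^{x,y} η`, in which the opinions at `x` and `y` are exchanged. -/
def exchange {d n : ℕ} (x y : Torus d n) (η : Config d n) : Config d n :=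
  fun z => η (Equiv.swap x y z)

/-- The set of nearest neighbours of `x` in the torus. (For `n = 1` this is `{x}`, which does not
contribute to the voter generator.) -/
def neighbors {d n : ℕ} [NeZero n] (x : Torus d n) : Finset (Torus d n) :=
  Finset.univ.filter fun y => ∃ j : Fin d, y = x + Pi.single j 1 ∨ y = x - Pi.single j 1

/-- The generator of the voter model. -/
def voterGen (d n : ℕ) [NeZero n] : (Config d n → ℝ) →ₗ[ℝ] (Config d n → ℝ) where
  toFun f η := ∑ x, ∑ y ∈ neighbors x, (occ (η y) - occ (η x)) ^ 2 * (f (flip x η) - f η)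
  map_add' f g := by
    funext η
    simp only [Pi.add_apply, ← Finset.sum_add_distrib]
    exact Finset.sum_congr rfl fun x _ => Finset.sum_congr rfl fun y _ => by ring
  map_smul' r f := by
    funext η
    simp only [Pi.smul_apply, smul_eq_mul, RingHom.id_apply, Finset.mul_sum]
    exact Finset.sum_congr rfl fun x _ => Finset.sum_congr rfl fun y _ => by ring

/-- The generator of the symmetric exclusion process with speed change. -/
def exclusionGen (d n : ℕ) [NeZero n] (c : Fin d → LatticeConfig d → ℝ) :
    (Config d n → ℝ) →ₗ[ℝ] (Config d n → ℝ) where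
  toFun f η := ∑ x, ∑ j, c j (torusShift x η) * (f (exchange x (x + Pi.single j 1) η) - f η)
  map_add' f g := by
    funext η
    simp only [Pi.add_apply, ← Finset.sum_add_distrib]
    exact Finset.sum_congr rfl fun x _ => Finset.sum_congr rfl fun y _ => by ring
  map_smul' r f := by
    funext η
    simp only [Pi.smul_apply, smul_eq_mul, RingHom.id_apply, Finset.mul_sum]
    exact Finset.sum_congr rfl fun x _ => Finset.sum_congr rfl fun y _ => by ring

/-- The generator `n² L^S + a L^V` of the voter model with stirring. -/
def generator (d n : ℕ) [NeZero n] (c : Fin d → LatticeConfig d → ℝ) (a : ℝ) :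
    (Config d n → ℝ) →ₗ[ℝ] (Config d n → ℝ) :=
  (n : ℝ) ^ 2 • exclusionGen d n c + a • voterGen d n

/-- The semigroup `S(t) = exp (t L)` of the voter model with stirring, a Markov chain on a finite
state space. -/
def semigroup (d n : ℕ) [NeZero n] (c : Fin d → LatticeConfig d → ℝ) (a t : ℝ) :
    (Config d n → ℝ) →L[ℝ] (Config d n → ℝ) :=
  NormedSpace.exp (t • LinearMap.toContinuousLinearMap (generator d n c a))

/-- The law `μ S(t)` at time `t ≥ 0` of the chain with initial law `μ`: the mass of `{η}` is
`∫ S(t) 1_{η} dμ`. -/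
def lawAt {d n : ℕ} [NeZero n] (c : Fin d → LatticeConfig d → ℝ) (a : ℝ)
    (μ : Measure (Config d n)) (t : ℝ) : Measure (Config d n) :=
  ∑ η, ENNReal.ofReal (∫ ξ, semigroup d n c a t (Pi.single η 1) ξ ∂μ) • Measure.dirac η

/-- The Bernoulli product measure with density `ρ`. -/
def bernoulliProd (d n : ℕ) [NeZero n] (ρ : ℝ) : Measure (Config d n) :=
  Measure.pi fun _ =>
    ENNReal.ofReal ρ • Measure.dirac true + ENNReal.ofReal (1 - ρ) • Measure.dirac false

/-- Relative entropy of `μ` with respect to `ν` on a finite space, through its variational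
formula. The supremum is a supremum of a bounded set as soon as `ν` charges every point. -/
def relEntropy {Ω : Type*} [MeasurableSpace Ω] (μ ν : Measure Ω) : ℝ :=
  ⨆ f : Ω → ℝ, (∫ ω, f ω ∂μ - Real.log (∫ ω, Real.exp (f ω) ∂ν))

theorem relEntropy_bddAbove {Ω : Type*} [Fintype Ω] [Nonempty Ω] [MeasurableSpace Ω]
    [MeasurableSingletonClass Ω] (μ ν : Measure Ω) [IsProbabilityMeasure μ]
    [IsProbabilityMeasure ν] (hν : ∀ ω, 0 < ν.real {ω}) :
    BddAbove (Set.range fun f : Ω → ℝ =>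
      ∫ ω, f ω ∂μ - Real.log (∫ ω, Real.exp (f ω) ∂ν)) := by
  obtain ⟨ω₀, h₀⟩ := Finite.exists_min fun ω => ν.real {ω}
  refine ⟨-Real.log (ν.real {ω₀}), ?_⟩
  rintro _ ⟨f, rfl⟩
  obtain ⟨m, hm⟩ := Finite.exists_max f
  have h1 : ∫ ω, f ω ∂μ ≤ f m := by
    calc ∫ ω, f ω ∂μ ≤ ∫ _, f m ∂μ := integral_mono .of_finite .of_finite hm
      _ = f m := by simp
  have h2 : ν.real {ω₀} * Real.exp (f m) ≤ ∫ ω, Real.exp (f ω) ∂ν := by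
    rw [integral_fintype .of_finite]
    calc ν.real {ω₀} * Real.exp (f m) ≤ ν.real {m} • Real.exp (f m) :=
          mul_le_mul_of_nonneg_right (h₀ m) (Real.exp_pos _).le
      _ ≤ _ := Finset.single_le_sum (f := fun ω => ν.real {ω} • Real.exp (f ω))
          (fun ω _ => mul_nonneg (hν ω).le (Real.exp_pos _).le) (Finset.mem_univ m)
  have h3 := Real.log_le_log (mul_pos (hν ω₀) (Real.exp_pos _)) h2
  rw [Real.log_mul (hν ω₀).ne' (Real.exp_pos _).ne', Real.log_exp] at h3
  simp only
  linarith

/-- The entropy `H_n(t)` of `μ S(t)` with respect to the Bernoulli measure. -/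
def entropyAt {d n : ℕ} [NeZero n] (c : Fin d → LatticeConfig d → ℝ) (a ρ : ℝ)
    (μ : Measure (Config d n)) (t : ℝ) : ℝ :=
  relEntropy (lawAt c a μ t) (bernoulliProd d n ρ)

/-- The error term `R_d(n)`, with `a = a_n` (used for `d ≥ 1`). -/
def errorTerm (d n : ℕ) (a : ℝ) : ℝ :=
  if d = 1 then √a else if d = 2 then a * Real.log n else a * (n : ℝ) ^ (d - 2)

/-- The differential inequality `H' ≤ C a (H + R_d(n))` on `[0, ∞)` and its integrated form.
At positive times `H` is differentiable. At time `0`, where the law may vanish at some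
configurations, `H'` is the right derivative, which exists as an extended real number
(possibly `-∞`). -/
structure EntropyBound {d n : ℕ} [NeZero n] (c : Fin d → LatticeConfig d → ℝ) (a ρ : ℝ)
    (μ : Measure (Config d n)) (C : ℝ) : Prop where
  deriv_pos : ∀ t : ℝ, 0 < t → ∃ D : ℝ, HasDerivAt (entropyAt c a ρ μ) D t ∧
    D ≤ C * a * (entropyAt c a ρ μ t + errorTerm d n a)
  deriv_zero : ∃ D : EReal,
    Tendsto (fun t : ℝ => (((entropyAt c a ρ μ t - entropyAt c a ρ μ 0) / t : ℝ) : EReal))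
      (𝓝[>] 0) (𝓝 D) ∧
    D ≤ ((C * a * (entropyAt c a ρ μ 0 + errorTerm d n a) : ℝ) : EReal)
  integrated : ∀ t : ℝ, 0 ≤ t →
    entropyAt c a ρ μ t ≤ (entropyAt c a ρ μ 0 + errorTerm d n a) * Real.exp (C * a * t)

end VoterStirring

end

/-!
The exclusion part of the dynamics is reversible with respect to the Bernoulli measure `ν`, and the
voter part is not. For a finite chain the derivative of the relative entropy is at most
`2 ∫ √f L √f dν`, `f` being the density (`IsMarkovGen.hasDerivAt_ent`), so
`IsMarkovGen.entropy_bound` and `entropyBound_of_production` reduce the theorem to a bound of this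
entropy production that is uniform in the law. The exclusion part contributes minus `n²` times a
Dirichlet form. The voter part contributes at most the mean under `f dν` of the adjoint voter
generator applied to `1`, which is `2 a / (ρ (1 - ρ))` times the interaction `∑ ω_x ω_y` over the
bonds, with `ω = η - ρ` (`production_voterGen_le`).

The interaction is controlled through the resolvent of the discrete Laplacian at `l = a / n²`. Let
`E(η) = ⟨ω, (l - Δ)⁻¹ ω⟩` be the `energy`. The exchange generator with unit rates maps `E / 2` to
`l E`, minus a nonnegative term, minus a positive multiple of the interaction: pairs of particles
perform random walks, except when they are neighbours
(`two_mul_greenStep_mul_interaction`). Integrating by parts, the mean interaction is bounded by a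
multiple of the Dirichlet form, which the exclusion production absorbs, and by the mean of `l E`
(`interaction_le`). The squared increments of `E` under exchanges sum up to a squared gradient of
the potential `(l - Δ)⁻¹ ω`, which is again at most `E`.

The mean of `l E` is bounded by the entropy inequality, at the price of an exponential moment under
`ν` (`sum_mul_energy_le`). In the orthonormal Hartley basis the quadratic form `l E` is diagonal
with eigenvalues at most `1`, and Gaussian linearization bounds the moment by the exponential of
its trace `l n^d G(0)`, where `G` is the Green function (`sum_bern_mul_exp_quadratic_le`). Finally
`G(0)` is the Laplace transform of the return probability of a random walk on the torus, a product
over the coordinates, which gives `l n^d G(0) = O(R_d(n))` (`mul_greenZero_le_errorTerm`). On the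
finitely many small tori the production is bounded because the state space is finite.
-/

noncomputable section

namespace VoterStirring

/-! ### Markov chains on a finite state space -/

/-- A Markov generator on a finite state space: the jump rate from `ξ` to `η ≠ ξ` is
`L 1_{η} (ξ)`. -/
structure IsMarkovGen {Ω : Type*} [DecidableEq Ω] (L : (Ω → ℝ) →ₗ[ℝ] (Ω → ℝ)) : Prop where
  rate_nonneg : ∀ ξ η, ξ ≠ η → 0 ≤ L (Pi.single η 1) ξ
  map_one : L 1 = 0

section Chain

variable {Ω : Type*} [Fintype Ω] [DecidableEq Ω]

/-- The mass function at time `t` of the chain with generator `L` and initial masses `m`. -/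
def evolve (L : (Ω → ℝ) →ₗ[ℝ] (Ω → ℝ)) (m : Ω → ℝ) (t : ℝ) (η : Ω) : ℝ :=
  ∑ ξ, m ξ * NormedSpace.exp (t • LinearMap.toContinuousLinearMap L) (Pi.single η 1) ξ

lemma linearMap_apply_eq_sum (L : (Ω → ℝ) →ₗ[ℝ] (Ω → ℝ)) (φ : Ω → ℝ) (ξ : Ω) :
    L φ ξ = ∑ η, φ η * L (Pi.single η 1) ξ := by
  conv_lhs => rw [pi_eq_sum_univ' φ]
  simp only [map_sum, map_smul, Finset.sum_apply, Pi.smul_apply, smul_eq_mul]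

lemma IsMarkovGen.apply_eq_sum {L : (Ω → ℝ) →ₗ[ℝ] (Ω → ℝ)} (hL : IsMarkovGen L) (φ : Ω → ℝ)
    (ξ : Ω) : L φ ξ = ∑ η, (φ η - φ ξ) * L (Pi.single η 1) ξ := by
  have h := linearMap_apply_eq_sum L 1 ξ
  rw [hL.map_one] at h
  simp only [Pi.zero_apply, Pi.one_apply, one_mul] at h
  simp only [sub_mul, Finset.sum_sub_distrib, ← Finset.mul_sum, ← h, mul_zero, sub_zero]
  exact linearMap_apply_eq_sum L φ ξ

lemma evolve_zero (L : (Ω → ℝ) →ₗ[ℝ] (Ω → ℝ)) (m : Ω → ℝ) : evolve L m 0 = m := by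
  funext η
  simp [evolve, Pi.single_apply]

/-- The Kolmogorov forward equation. -/
lemma hasDerivAt_evolve (L : (Ω → ℝ) →ₗ[ℝ] (Ω → ℝ)) (m : Ω → ℝ) (η : Ω) (t : ℝ) :
    HasDerivAt (fun s => evolve L m s η) (∑ ζ, evolve L m t ζ * L (Pi.single η 1) ζ) t := by
  set A := LinearMap.toContinuousLinearMap L
  have h1 : ∀ ξ, HasDerivAt (fun s => m ξ * NormedSpace.exp (s • A) (Pi.single η 1) ξ)
      (m ξ * (NormedSpace.exp (t • A) * A) (Pi.single η 1) ξ) t := fun ξ => by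
    have h := hasDerivAt_exp_smul_const (𝕂 := ℝ) A t
    have h2 := (hasDerivAt_pi.1 (h.clm_apply (hasDerivAt_const t (Pi.single η (1 : ℝ))))) ξ
    simpa using h2.const_mul (m ξ)
  have h2 := HasDerivAt.fun_sum (u := Finset.univ) fun ξ _ => h1 ξ
  refine h2.congr_deriv (Eq.symm ?_)
  simp only [evolve, Finset.sum_mul]
  rw [Finset.sum_comm]
  refine Finset.sum_congr rfl fun ξ _ => ?_
  have h3 := linearMap_apply_eq_sum (NormedSpace.exp (t • A)).toLinearMap (A (Pi.single η 1)) ξ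
  simp only [ContinuousLinearMap.coe_coe] at h3
  rw [mul_apply_eq_comp, h3, Finset.mul_sum]
  refine Finset.sum_congr rfl fun ζ _ => ?_
  simp only [A, LinearMap.coe_toContinuousLinearMap']
  ring

lemma continuous_evolve (L : (Ω → ℝ) →ₗ[ℝ] (Ω → ℝ)) (m : Ω → ℝ) (η : Ω) :
    Continuous fun t => evolve L m t η :=
  continuous_iff_continuousAt.2 fun t => (hasDerivAt_evolve L m η t).continuousAt

lemma analyticOnNhd_evolve (L : (Ω → ℝ) →ₗ[ℝ] (Ω → ℝ)) (m : Ω → ℝ) (η : Ω) :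
    AnalyticOnNhd ℝ (fun t => evolve L m t η) Set.univ := fun t _ => by
  set A := LinearMap.toContinuousLinearMap L
  have h0 : AnalyticAt ℝ (fun s : ℝ => NormedSpace.exp (s • A)) t :=
    (NormedSpace.exp_analytic (𝕂 := ℝ) (t • A)).fun_comp
      (f := fun s : ℝ => s • A) (analyticAt_id.smul analyticAt_const)
  refine Finset.analyticAt_fun_sum _ fun ξ _ => analyticAt_const.mul ?_
  let ev : ((Ω → ℝ) →L[ℝ] (Ω → ℝ)) →L[ℝ] ℝ :=
    (ContinuousLinearMap.proj (R := ℝ) (φ := fun _ : Ω => ℝ) ξ).comp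
      (ContinuousLinearMap.apply ℝ (Ω → ℝ) (Pi.single η (1 : ℝ)))
  exact (ev.analyticAt _).fun_comp h0

/-- The transition probabilities are nonnegative: `exp (t L) = e^{-tq} exp (t (L + q))`, where
`L + q` preserves nonnegativity for large `q`. -/
lemma IsMarkovGen.exp_nonneg {L : (Ω → ℝ) →ₗ[ℝ] (Ω → ℝ)} (hL : IsMarkovGen L) {t : ℝ}
    (ht : 0 ≤ t) (φ : Ω → ℝ) (hφ : ∀ ξ, 0 ≤ φ ξ) (ξ : Ω) :
    0 ≤ NormedSpace.exp (t • LinearMap.toContinuousLinearMap L) φ ξ := by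
  set A := LinearMap.toContinuousLinearMap L
  obtain ⟨q, hq⟩ : ∃ q : ℝ, ∀ ζ, -q ≤ L (Pi.single ζ 1) ζ := by
    obtain ⟨q, hq⟩ := Finite.bddAbove_range fun ζ => -L (Pi.single ζ 1) ζ
    exact ⟨q, fun ζ => by linarith [hq (Set.mem_range_self ζ)]⟩
  set B : (Ω → ℝ) →L[ℝ] (Ω → ℝ) := A + q • 1 with hB
  have hBpos : ∀ ψ : Ω → ℝ, (∀ ζ, 0 ≤ ψ ζ) → ∀ ζ, 0 ≤ B ψ ζ := fun ψ hψ ζ => by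
    have h1 : B ψ ζ = ∑ η, ψ η * L (Pi.single η 1) ζ + q * ψ ζ := by
      rw [← linearMap_apply_eq_sum]
      simp [hB, A]
    rw [h1, ← Finset.add_sum_erase _ _ (Finset.mem_univ ζ)]
    have h2 : 0 ≤ ∑ η ∈ Finset.univ.erase ζ, ψ η * L (Pi.single η 1) ζ :=
      Finset.sum_nonneg fun η hη =>
        mul_nonneg (hψ η) (hL.rate_nonneg ζ η (Finset.ne_of_mem_erase hη).symm)
    nlinarith [hq ζ, hψ ζ]
  have hpow : ∀ k : ℕ, ∀ ζ, 0 ≤ ((t • B) ^ k) φ ζ := fun k => by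
    induction k with
    | zero => simpa using hφ
    | succ k ih =>
      intro ζ
      rw [pow_succ', mul_apply_eq_comp]
      exact mul_nonneg ht (hBpos _ ih ζ)
  have hexpB : 0 ≤ NormedSpace.exp (t • B) φ ξ := by
    let ev : ((Ω → ℝ) →L[ℝ] (Ω → ℝ)) →L[ℝ] ℝ :=
      (ContinuousLinearMap.proj (R := ℝ) (φ := fun _ : Ω => ℝ) ξ).comp
        (ContinuousLinearMap.apply ℝ (Ω → ℝ) φ)
    have h := (NormedSpace.exp_series_hasSum_exp' (𝕂 := ℝ) (t • B)).mapL ev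
    refine h.nonneg fun k => ?_
    have : ev (((k.factorial : ℝ)⁻¹) • (t • B) ^ k)
        = ((k.factorial : ℝ)⁻¹) * ((t • B) ^ k) φ ξ := by
      simp [ev]
    rw [this]
    exact mul_nonneg (by positivity) (hpow k ξ)
  have hcomm : Commute (t • B) ((-(t * q)) • (1 : (Ω → ℝ) →L[ℝ] (Ω → ℝ))) :=
    (Commute.one_right _).smul_right _
  have hsum : t • A = t • B + (-(t * q)) • (1 : (Ω → ℝ) →L[ℝ] (Ω → ℝ)) := by
    rw [hB, smul_add, smul_smul, add_assoc, ← add_smul, add_neg_cancel, zero_smul, add_zero]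
  have hone : NormedSpace.exp ((-(t * q)) • (1 : (Ω → ℝ) →L[ℝ] (Ω → ℝ)))
      = Real.exp (-(t * q)) • (1 : (Ω → ℝ) →L[ℝ] (Ω → ℝ)) := by
    have := NormedSpace.algebraMap_exp_comm (𝕂 := ℝ) (𝔸 := (Ω → ℝ) →L[ℝ] (Ω → ℝ)) (-(t * q))
    rw [Algebra.algebraMap_eq_smul_one, Algebra.algebraMap_eq_smul_one] at this
    rw [← this, Real.exp_eq_exp_ℝ]
  let _ : NormedAlgebra ℚ ((Ω → ℝ) →L[ℝ] (Ω → ℝ)) := NormedAlgebra.restrictScalars ℚ ℝ _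
  rw [hsum, NormedSpace.exp_add_of_commute hcomm, hone]
  simp only [mul_smul_comm, mul_one, smul_apply, Pi.smul_apply, smul_eq_mul]
  exact mul_nonneg (Real.exp_pos _).le hexpB

lemma IsMarkovGen.evolve_nonneg {L : (Ω → ℝ) →ₗ[ℝ] (Ω → ℝ)} (hL : IsMarkovGen L) {m : Ω → ℝ}
    (hm : ∀ ξ, 0 ≤ m ξ) {t : ℝ} (ht : 0 ≤ t) (η : Ω) : 0 ≤ evolve L m t η :=
  Finset.sum_nonneg fun ξ _ => mul_nonneg (hm ξ) (hL.exp_nonneg ht _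
    (fun ζ => by rw [Pi.single_apply]; split_ifs <;> norm_num) ξ)

lemma IsMarkovGen.sum_evolve {L : (Ω → ℝ) →ₗ[ℝ] (Ω → ℝ)} (hL : IsMarkovGen L) (m : Ω → ℝ)
    (t : ℝ) : ∑ η, evolve L m t η = ∑ η, m η := by
  have hd : ∀ s, HasDerivAt (fun s => ∑ η, evolve L m s η) 0 s := fun s => by
    have h := HasDerivAt.fun_sum (u := Finset.univ) fun η _ => hasDerivAt_evolve L m η s
    refine h.congr_deriv ?_
    rw [Finset.sum_comm]
    refine Finset.sum_eq_zero fun ζ _ => ?_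
    have h1 := linearMap_apply_eq_sum L 1 ζ
    rw [hL.map_one] at h1
    simp only [Pi.zero_apply, Pi.one_apply, one_mul] at h1
    rw [← Finset.mul_sum, ← h1, mul_zero]
  have := is_const_of_deriv_eq_zero (fun s => (hd s).differentiableAt) (fun s => (hd s).deriv) t 0
  simpa [evolve_zero] using this

/-- A state that has mass at some time has mass at all later times, since mass leaves a state at
a bounded rate. -/
lemma IsMarkovGen.evolve_pos_of_le {L : (Ω → ℝ) →ₗ[ℝ] (Ω → ℝ)} (hL : IsMarkovGen L) {m : Ω → ℝ}
    (hm : ∀ ξ, 0 ≤ m ξ) {s t : ℝ} (hs : 0 ≤ s) (hst : s ≤ t) {η : Ω}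
    (h : 0 < evolve L m s η) : 0 < evolve L m t η := by
  set q : ℝ := -L (Pi.single η 1) η
  have hd : ∀ r, HasDerivAt (fun r => Real.exp (q * r) * evolve L m r η)
      (Real.exp (q * r) * q * evolve L m r η
        + Real.exp (q * r) * ∑ ζ, evolve L m r ζ * L (Pi.single η 1) ζ) r := fun r => by
    have h1 : HasDerivAt (fun r => Real.exp (q * r)) (Real.exp (q * r) * q) r := by
      simpa using ((hasDerivAt_id r).const_mul q).exp
    exact h1.mul (hasDerivAt_evolve L m η r)
  have hmono : MonotoneOn (fun r => Real.exp (q * r) * evolve L m r η) (Set.Ici 0) := by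
    refine monotoneOn_of_deriv_nonneg (convex_Ici 0)
      (fun r _ => (hd r).continuousAt.continuousWithinAt)
      (fun r _ => (hd r).differentiableAt.differentiableWithinAt) fun r hr => ?_
    rw [interior_Ici] at hr
    rw [(hd r).deriv, ← Finset.add_sum_erase _ _ (Finset.mem_univ η)]
    have h2 : 0 ≤ ∑ ζ ∈ Finset.univ.erase η, evolve L m r ζ * L (Pi.single η 1) ζ :=
      Finset.sum_nonneg fun ζ hζ => mul_nonneg (hL.evolve_nonneg hm (le_of_lt hr) ζ)
        (hL.rate_nonneg ζ η (Finset.ne_of_mem_erase hζ))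
    have := mul_nonneg (Real.exp_pos (q * r)).le h2
    simp only [q] at *
    linarith
  have h3 := hmono (Set.mem_Ici.2 hs) (Set.mem_Ici.2 (hs.trans hst)) hst
  have h4 : 0 < Real.exp (q * t) * evolve L m t η :=
    lt_of_lt_of_le (mul_pos (Real.exp_pos _) h) h3
  exact (mul_pos_iff_of_pos_left (Real.exp_pos _)).1 h4

/-- A state without mass at some positive time never has mass: the mass vanishes on a time
interval, and it is analytic in time. -/
lemma IsMarkovGen.evolve_eq_zero {L : (Ω → ℝ) →ₗ[ℝ] (Ω → ℝ)} (hL : IsMarkovGen L) {m : Ω → ℝ}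
    (hm : ∀ ξ, 0 ≤ m ξ) {s : ℝ} (hs : 0 < s) {η : Ω} (h : evolve L m s η = 0) (t : ℝ) :
    evolve L m t η = 0 := by
  have hz : ∀ᶠ r in 𝓝 (s / 2), evolve L m r η = 0 := by
    filter_upwards [Ioo_mem_nhds (half_pos hs) (half_lt_self hs)] with r hr
    by_contra hne
    have hpos := (hL.evolve_nonneg hm hr.1.le η).lt_of_ne' hne
    exact (hL.evolve_pos_of_le hm hr.1.le hr.2.le hpos).ne' h
  exact (analyticOnNhd_evolve L m η).eqOn_zero_of_preconnected_of_eventuallyEq_zero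
    isPreconnected_univ (Set.mem_univ (s / 2)) hz (Set.mem_univ t)

end Chain

/-! ### Entropy production along a finite chain -/

section Entropy

variable {Ω : Type*} [Fintype Ω] [DecidableEq Ω]

/-- The relative entropy `∑ m log (m / ν)` of a mass function `m` with respect to a positive mass
function `ν`. -/
def ent (ν m : Ω → ℝ) : ℝ := ∑ η, m η * (Real.log (m η) - Real.log (ν η))

/-- The elementary inequality behind the entropy production bound. -/
lemma mul_log_sub_log_le {a b : ℝ} (ha : 0 < a) (hb : 0 < b) :
    a * (Real.log b - Real.log a) ≤ 2 * (√a * (√b - √a)) := by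
  have hsa := Real.sqrt_pos.2 ha
  have hsb := Real.sqrt_pos.2 hb
  have h1 : Real.log b - Real.log a = 2 * Real.log (√b / √a) := by
    rw [Real.log_div hsb.ne' hsa.ne', Real.log_sqrt hb.le, Real.log_sqrt ha.le]
    ring
  have h2 := Real.log_le_sub_one_of_pos (div_pos hsb hsa)
  have h3 : a = √a * √a := (Real.mul_self_sqrt ha.le).symm
  calc a * (Real.log b - Real.log a) = 2 * (√a * √a * Real.log (√b / √a)) := by
        rw [h1, ← h3]; ring
    _ ≤ 2 * (√a * √a * (√b / √a - 1)) := by gcongr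
    _ = 2 * (√a * (√b - √a)) := by field_simp

/-- Twice the quadratic form of `L` at the square root of the density `m / ν`. -/
def production (L : (Ω → ℝ) →ₗ[ℝ] (Ω → ℝ)) (ν m : Ω → ℝ) : ℝ :=
  2 * ∑ ξ, ν ξ * (√(m ξ / ν ξ) * L (fun η => √(m η / ν η)) ξ)

lemma continuous_ent_evolve (L : (Ω → ℝ) →ₗ[ℝ] (Ω → ℝ)) (ν m : Ω → ℝ) :
    Continuous fun t => ent ν (evolve L m t) := by
  unfold ent
  refine continuous_finsetSum _ fun η _ => ?_
  simp only [mul_sub]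
  exact (Real.continuous_mul_log.comp (continuous_evolve L m η)).sub
    ((continuous_evolve L m η).mul continuous_const)

/-- At positive times the entropy is differentiable, and its derivative is at most twice the
quadratic form of the generator at the square root of the density. States that never carry mass
do not contribute. -/
lemma IsMarkovGen.hasDerivAt_ent {L : (Ω → ℝ) →ₗ[ℝ] (Ω → ℝ)} (hL : IsMarkovGen L)
    {ν m : Ω → ℝ} (hν : ∀ ξ, 0 < ν ξ) (hm : ∀ ξ, 0 ≤ m ξ) {t : ℝ} (ht : 0 < t) :
    ∃ D, HasDerivAt (fun s => ent ν (evolve L m s)) D t ∧ D ≤ production L ν (evolve L m t) := by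
  set p := evolve L m t with hp
  have hp0 : ∀ ξ, 0 ≤ p ξ := hL.evolve_nonneg hm ht.le
  set p' : Ω → ℝ := fun η => ∑ ζ, p ζ * L (Pi.single η 1) ζ with hp'
  have hd : ∀ η, HasDerivAt (fun s => evolve L m s η) (p' η) t := fun η =>
    hasDerivAt_evolve L m η t
  have hzero : ∀ η, p η = 0 → p' η = 0 := fun η h => by
    have h1 : (fun s => evolve L m s η) = fun _ => 0 :=
      funext fun s => hL.evolve_eq_zero hm ht h s
    have h2 := hd η
    rw [h1] at h2
    exact h2.unique (hasDerivAt_const t 0)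
  have hsum : ∑ η, p' η = 0 := by
    have h := HasDerivAt.fun_sum (u := Finset.univ) fun η _ => hd η
    have h1 : (fun s => ∑ η, evolve L m s η) = fun _ => ∑ η, m η :=
      funext fun s => hL.sum_evolve m s
    rw [h1] at h
    exact h.unique (hasDerivAt_const t _)
  set ψ : Ω → ℝ := fun η => Real.log (p η) - Real.log (ν η) with hψ
  refine ⟨∑ η, (p' η * ψ η + p' η), ?_, ?_⟩
  · unfold ent
    refine HasDerivAt.fun_sum fun η _ => ?_
    by_cases h : p η = 0
    · have h1 : (fun s => evolve L m s η * (Real.log (evolve L m s η) - Real.log (ν η)))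
          = fun _ => 0 := funext fun s => by
        rw [hL.evolve_eq_zero hm ht h s, zero_mul]
      rw [h1, hzero η h]
      simpa using hasDerivAt_const t (0 : ℝ)
    · have h1 := (hd η).mul (((hd η).log h).sub_const (Real.log (ν η)))
      refine h1.congr_deriv ?_
      simp only [hψ]
      field_simp
      rw [← hp]
      field_simp
  · rw [Finset.sum_add_distrib, hsum, add_zero]
    have h1 : ∑ η, p' η * ψ η = ∑ ξ, p ξ * L ψ ξ := by
      simp only [hp', Finset.sum_mul]
      rw [Finset.sum_comm]
      refine Finset.sum_congr rfl fun ξ _ => ?_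
      rw [linearMap_apply_eq_sum L ψ ξ, Finset.mul_sum]
      exact Finset.sum_congr rfl fun η _ => by ring
    rw [h1, production, Finset.mul_sum]
    refine Finset.sum_le_sum fun ξ _ => ?_
    rw [hL.apply_eq_sum ψ, hL.apply_eq_sum, Finset.mul_sum, Finset.mul_sum, Finset.mul_sum,
      Finset.mul_sum]
    refine Finset.sum_le_sum fun η _ => ?_
    rcases eq_or_ne ξ η with rfl | hne
    · simp
    rcases (hp0 ξ).eq_or_lt with h0 | h0
    · simp [← h0]
    have hr := hL.rate_nonneg ξ η hne
    rcases hr.eq_or_lt with hr0 | hr0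
    · simp [← hr0]
    -- mass flows from `ξ` to `η`, so `η` carries mass as well
    have hη : 0 < p η := by
      refine (hp0 η).lt_of_ne' fun h => ?_
      have h2 := hzero η h
      have h3 : 0 < p' η := by
        refine Finset.sum_pos' (fun ζ _ => ?_) ⟨ξ, Finset.mem_univ _, mul_pos h0 hr0⟩
        rcases eq_or_ne ζ η with rfl | hζ
        · simp [h]
        · exact mul_nonneg (hp0 ζ) (hL.rate_nonneg ζ η hζ)
      exact h3.ne' h2
    have h4 := mul_log_sub_log_le (div_pos h0 (hν ξ)) (div_pos hη (hν η))
    rw [Real.log_div hη.ne' (hν η).ne', Real.log_div h0.ne' (hν ξ).ne'] at h4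
    have h5 := mul_le_mul_of_nonneg_left h4 (mul_nonneg (hν ξ).le hr)
    have hν' := (hν ξ).ne'
    have h6 : ν ξ * L (Pi.single η 1) ξ *
        (p ξ / ν ξ * (Real.log (p η) - Real.log (ν η) - (Real.log (p ξ) - Real.log (ν ξ))))
        = p ξ * ((ψ η - ψ ξ) * L (Pi.single η 1) ξ) := by
      simp only [hψ]
      field_simp
    rw [h6] at h5
    refine h5.trans (le_of_eq ?_)
    ring

/-- Having a limit in `[-∞, ∞)` is stable under finite sums. -/
lemma tendsto_sum_nhds_or_atBot {ι α : Type*} (s : Finset ι) {l : Filter α} {f : ι → α → ℝ}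
    (h : ∀ i ∈ s, (∃ r, Tendsto (f i) l (𝓝 r)) ∨ Tendsto (f i) l atBot) :
    (∃ r, Tendsto (fun a => ∑ i ∈ s, f i a) l (𝓝 r)) ∨
      Tendsto (fun a => ∑ i ∈ s, f i a) l atBot := by
  classical
  induction s using Finset.induction_on with
  | empty => exact Or.inl ⟨0, by simpa using tendsto_const_nhds⟩
  | insert i s hi ih =>
    simp only [Finset.sum_insert hi]
    have h1 := ih fun j hj => h j (Finset.mem_insert_of_mem hj)
    rcases h i (Finset.mem_insert_self i s) with ⟨r, hr⟩ | hr <;> rcases h1 with ⟨r', hr'⟩ | hr'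
    · exact Or.inl ⟨_, hr.add hr'⟩
    · exact Or.inr (hr.add_atBot hr')
    · exact Or.inr (hr.atBot_add hr')
    · exact Or.inr (hr.atBot_add_atBot hr')

/-- If `y ≥ 0` is differentiable to second order at `0` with `y 0 = 0`, then the right derivative
of `y log y - κ y` at `0` exists in `[-∞, ∞)`: it is `-∞` if `y' 0 > 0`, and `0` if `y' 0 = 0`. -/
lemma tendsto_mul_log_div {y y' : ℝ → ℝ} {y'' κ : ℝ} (hy : ∀ t, HasDerivAt y (y' t) t)
    (hy' : HasDerivAt y' y'' 0) (h0 : y 0 = 0) (hnn : ∀ t, 0 ≤ t → 0 ≤ y t) :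
    (∃ r, Tendsto (fun t => y t * (Real.log (y t) - κ) / t) (𝓝[>] 0) (𝓝 r)) ∨
      Tendsto (fun t => y t * (Real.log (y t) - κ) / t) (𝓝[>] 0) atBot := by
  have hslope : Tendsto (fun t => y t / t) (𝓝[>] 0) (𝓝 (y' 0)) := by
    have h := (hasDerivWithinAt_iff_tendsto_slope' (s := Set.Ioi (0 : ℝ)) (by simp)).1
      (hy 0).hasDerivWithinAt
    refine h.congr fun t => ?_
    simp [slope_def_field, h0]
  have hr0 : 0 ≤ y' 0 := ge_of_tendsto hslope (by
    filter_upwards [self_mem_nhdsWithin] with t ht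
    exact div_nonneg (hnn t (le_of_lt ht)) (le_of_lt ht))
  have hyt : Tendsto y (𝓝[>] 0) (𝓝 0) := by
    have := (hy 0).continuousAt.tendsto
    rw [h0] at this
    exact this.mono_left nhdsWithin_le_nhds
  rcases hr0.eq_or_lt with hr | hr
  · left
    refine ⟨0, ?_⟩
    -- `y = O(t²)`
    obtain ⟨c, hc0, hc⟩ : ∃ c : ℝ, 0 ≤ c ∧ ∀ᶠ t in 𝓝[>] (0 : ℝ), y t ≤ c * t ^ 2 := by
      have hO := hy'.isBigO_sub
      simp only [← hr, sub_zero] at hO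
      obtain ⟨c, hc0, hc⟩ := hO.exists_nonneg
      obtain ⟨δ, hδ, hδ'⟩ := Metric.eventually_nhds_iff.1 hc.bound
      refine ⟨c, hc0, ?_⟩
      filter_upwards [Ioo_mem_nhdsGT hδ] with t ht
      have h := (convex_Icc (0 : ℝ) t).norm_image_sub_le_of_norm_hasDerivWithin_le
        (f := y) (f' := y') (C := c * t) (fun s _ => (hy s).hasDerivWithinAt)
        (fun s hs => by
          have h1 := hδ' (y := s) (by
            rw [Real.dist_eq, sub_zero, abs_of_nonneg hs.1]; exact hs.2.trans_lt ht.2)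
          refine h1.trans ?_
          rw [Real.norm_eq_abs, abs_of_nonneg hs.1]
          exact mul_le_mul_of_nonneg_left hs.2 hc0)
        (Set.left_mem_Icc.2 ht.1.le) (Set.right_mem_Icc.2 ht.1.le)
      rw [h0, sub_zero, sub_zero, Real.norm_eq_abs, Real.norm_eq_abs, abs_of_nonneg ht.1.le] at h
      nlinarith [le_abs_self (y t)]
    have h1 : Tendsto (fun t => √(y t) / t * (2 * (√(y t) * Real.log √(y t)))) (𝓝[>] 0)
        (𝓝 0) := by
      have h2 : Tendsto (fun t => 2 * (√(y t) * Real.log √(y t))) (𝓝[>] 0) (𝓝 0) := by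
        have h3 : Tendsto (fun t => √(y t)) (𝓝[>] 0) (𝓝 0) := by
          have h5 := (Real.continuous_sqrt.tendsto 0).comp hyt
          rwa [Real.sqrt_zero] at h5
        have h4 := (Real.continuous_mul_log.tendsto 0).comp h3
        simpa using h4.const_mul 2
      refine h2.zero_mul_isBoundedUnder_le ?_ |>.congr fun t => mul_comm _ _
      refine Filter.isBoundedUnder_of_eventually_le (a := √c) ?_
      filter_upwards [hc, self_mem_nhdsWithin] with t ht ht0
      have ht0' : 0 < t := ht0
      simp only [Function.comp_apply, Real.norm_eq_abs]
      rw [abs_of_nonneg (by positivity), div_le_iff₀ ht0']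
      calc √(y t) ≤ √(c * t ^ 2) := Real.sqrt_le_sqrt ht
        _ = √c * t := by rw [Real.sqrt_mul hc0, Real.sqrt_sq ht0'.le]
    have h5 := h1.sub (hslope.mul_const κ)
    rw [← hr, zero_mul, sub_zero] at h5
    refine h5.congr' ?_
    filter_upwards [self_mem_nhdsWithin] with t ht
    have hyn := hnn t (le_of_lt ht)
    have ht0 : t ≠ 0 := (ne_of_gt ht)
    rw [Real.log_sqrt hyn]
    have : √(y t) * √(y t) = y t := Real.mul_self_sqrt hyn
    field_simp
    linear_combination Real.log (y t) * this
  · right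
    have hpos : ∀ᶠ t in 𝓝[>] (0 : ℝ), 0 < y t := by
      filter_upwards [hslope.eventually (lt_mem_nhds hr), self_mem_nhdsWithin] with t h1 h2
      exact (div_pos_iff_of_pos_right h2).1 h1
    have hlog : Tendsto (fun t => Real.log (y t) - κ) (𝓝[>] 0) atBot := by
      refine tendsto_atBot_add_const_right _ (-κ) (Real.tendsto_log_nhdsGT_zero.comp ?_)
      exact tendsto_nhdsWithin_iff.2 ⟨hyt, hpos⟩
    exact (hslope.pos_mul_atBot hr hlog).congr fun t => by ring

lemma IsMarkovGen.tendsto_ent_slope {L : (Ω → ℝ) →ₗ[ℝ] (Ω → ℝ)} (hL : IsMarkovGen L)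
    (ν : Ω → ℝ) {m : Ω → ℝ} (hm : ∀ ξ, 0 ≤ m ξ) :
    ∃ D : EReal, Tendsto (fun t : ℝ =>
      (((ent ν (evolve L m t) - ent ν (evolve L m 0)) / t : ℝ) : EReal)) (𝓝[>] 0) (𝓝 D) := by
  have key : (∃ r, Tendsto (fun t : ℝ => ∑ η,
        (evolve L m t η * (Real.log (evolve L m t η) - Real.log (ν η))
          - evolve L m 0 η * (Real.log (evolve L m 0 η) - Real.log (ν η))) / t) (𝓝[>] 0) (𝓝 r)) ∨
      Tendsto (fun t : ℝ => ∑ η,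
        (evolve L m t η * (Real.log (evolve L m t η) - Real.log (ν η))
          - evolve L m 0 η * (Real.log (evolve L m 0 η) - Real.log (ν η))) / t)
        (𝓝[>] 0) atBot := by
    refine tendsto_sum_nhds_or_atBot _ fun η _ => ?_
    have hd := hasDerivAt_evolve L m η
    by_cases h : evolve L m 0 η = 0
    · have h1 : HasDerivAt (fun t => ∑ ζ, evolve L m t ζ * L (Pi.single η 1) ζ) _ 0 :=
        HasDerivAt.fun_sum (u := Finset.univ) fun ζ _ =>
          (hasDerivAt_evolve L m ζ 0).mul_const (L (Pi.single η 1) ζ)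
      have h2 := tendsto_mul_log_div (κ := Real.log (ν η)) hd h1 h
        (fun t ht => hL.evolve_nonneg hm ht η)
      simpa [h] using h2
    · left
      have h1 := (hd 0).mul (((hd 0).log h).sub_const (Real.log (ν η)))
      have h2 := (hasDerivWithinAt_iff_tendsto_slope' (s := Set.Ioi (0 : ℝ)) (by simp)).1
        h1.hasDerivWithinAt
      refine ⟨_, h2.congr fun t => ?_⟩
      simp [slope_def_field]
  have heq : ∀ t : ℝ, (ent ν (evolve L m t) - ent ν (evolve L m 0)) / t = ∑ η,
        (evolve L m t η * (Real.log (evolve L m t η) - Real.log (ν η))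
          - evolve L m 0 η * (Real.log (evolve L m 0 η) - Real.log (ν η))) / t := fun t => by
    rw [ent, ent, ← Finset.sum_sub_distrib, Finset.sum_div]
  simp only [heq]
  rcases key with ⟨r, hr⟩ | hr
  · exact ⟨r, (EReal.tendsto_coe).2 hr⟩
  · exact ⟨⊥, EReal.tendsto_coe_nhds_bot_iff.2 hr⟩

/-- A bound of the entropy production by `K (entropy + R)` gives the differential inequality for
the entropy at positive times, at time `0`, and its integrated form. -/
theorem IsMarkovGen.entropy_bound {L : (Ω → ℝ) →ₗ[ℝ] (Ω → ℝ)} (hL : IsMarkovGen L)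
    {ν m : Ω → ℝ} (hν : ∀ ξ, 0 < ν ξ) (hm : ∀ ξ, 0 ≤ m ξ) (hm1 : ∑ ξ, m ξ = 1) {K R : ℝ}
    (hR : 0 ≤ R)
    (hK : ∀ p : Ω → ℝ, (∀ ξ, 0 ≤ p ξ) → ∑ ξ, p ξ = 1 → production L ν p ≤ K * (ent ν p + R)) :
    (∀ t : ℝ, 0 < t → ∃ D : ℝ, HasDerivAt (fun s => ent ν (evolve L m s)) D t ∧
      D ≤ K * (ent ν (evolve L m t) + R)) ∧
    (∃ D : EReal, Tendsto (fun t : ℝ =>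
        (((ent ν (evolve L m t) - ent ν (evolve L m 0)) / t : ℝ) : EReal)) (𝓝[>] 0) (𝓝 D) ∧
      D ≤ ((K * (ent ν (evolve L m 0) + R) : ℝ) : EReal)) ∧
    (∀ t : ℝ, 0 ≤ t → ent ν (evolve L m t) ≤
      (ent ν (evolve L m 0) + R) * Real.exp (K * t)) := by
  set H : ℝ → ℝ := fun t => ent ν (evolve L m t) with hH
  have hcont : Continuous H := continuous_ent_evolve L ν m
  have h1 : ∀ t : ℝ, 0 < t → ∃ D : ℝ, HasDerivAt H D t ∧ D ≤ K * (H t + R) := fun t ht => by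
    obtain ⟨D, hD, hD'⟩ := hL.hasDerivAt_ent hν hm ht
    exact ⟨D, hD, hD'.trans (hK _ (hL.evolve_nonneg hm ht.le) ((hL.sum_evolve m t).trans hm1))⟩
  refine ⟨h1, ?_, ?_⟩
  · obtain ⟨D, hD⟩ := hL.tendsto_ent_slope ν hm
    refine ⟨D, hD, ?_⟩
    refine le_of_forall_gt fun b hb => ?_
    obtain ⟨b', hb1, hb2⟩ := EReal.lt_iff_exists_real_btwn.1 hb
    refine lt_of_le_of_lt ?_ hb2
    refine le_of_tendsto hD ?_
    have hc : ContinuousAt (fun t => K * (H t + R)) 0 := by fun_prop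
    have hev := hc.eventually (gt_mem_nhds (EReal.coe_lt_coe_iff.1 hb1))
    obtain ⟨δ, hδ, hδ'⟩ := Metric.eventually_nhds_iff.1 hev
    filter_upwards [Ioo_mem_nhdsGT hδ] with t ht
    obtain ⟨s, hs, hs'⟩ := exists_deriv_eq_slope H ht.1 hcont.continuousOn
      fun s hs => (h1 s hs.1).choose_spec.1.differentiableAt.differentiableWithinAt
    obtain ⟨D', hD', hD''⟩ := h1 s hs.1
    rw [hD'.deriv, sub_zero] at hs'
    refine EReal.coe_le_coe_iff.2 ?_
    rw [← hs']
    refine hD''.trans (hδ' ?_).le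
    rw [Real.dist_eq, sub_zero, abs_of_pos hs.1]
    exact hs.2.trans ht.2
  · intro t ht
    have hanti : AntitoneOn (fun t => (H t + R) * Real.exp (-(K * t))) (Set.Ici 0) := by
      have hd : ∀ t : ℝ, 0 < t → ∃ D, HasDerivAt (fun t => (H t + R) * Real.exp (-(K * t))) D t ∧
          D ≤ 0 := fun t ht => by
        obtain ⟨D, hD, hD'⟩ := h1 t ht
        have he : HasDerivAt (fun t => Real.exp (-(K * t))) (Real.exp (-(K * t)) * -K) t := by
          simpa using ((hasDerivAt_id t).const_mul K).neg.exp
        refine ⟨_, (hD.add_const R).mul he, ?_⟩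
        have := Real.exp_pos (-(K * t))
        nlinarith
      refine antitoneOn_of_deriv_nonpos (convex_Ici 0) (by fun_prop) (fun t ht => ?_)
        fun t ht => ?_
      · rw [interior_Ici] at ht
        exact (hd t ht).choose_spec.1.differentiableAt.differentiableWithinAt
      · rw [interior_Ici] at ht
        obtain ⟨D, hD, hD'⟩ := hd t ht
        rwa [hD.deriv]
    have h2 := hanti (Set.mem_Ici.2 le_rfl) (Set.mem_Ici.2 ht) ht
    simp only [mul_zero, neg_zero, Real.exp_zero, mul_one] at h2
    have h3 : H t + R = (H t + R) * Real.exp (-(K * t)) * Real.exp (K * t) := by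
      rw [mul_assoc, ← Real.exp_add]; simp
    have h4 := mul_le_mul_of_nonneg_right h2 (Real.exp_pos (K * t)).le
    rw [← h3] at h4
    exact (le_add_of_nonneg_right hR).trans h4

end Entropy

/-! ### The variational formula for the relative entropy -/

section Gibbs

variable {Ω : Type*} [Fintype Ω]

/-- The entropy inequality. -/
lemma sum_mul_le_ent_add_log [Nonempty Ω] {ν p : Ω → ℝ} (hν : ∀ ω, 0 < ν ω) (hp : ∀ ω, 0 ≤ p ω)
    (hp1 : ∑ ω, p ω = 1) (F : Ω → ℝ) :
    ∑ ω, p ω * F ω ≤ ent ν p + Real.log (∑ ω, ν ω * Real.exp (F ω)) := by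
  set Z := ∑ ω, ν ω * Real.exp (F ω) with hZ
  have hZ0 : 0 < Z := Finset.sum_pos (fun ω _ => mul_pos (hν ω) (Real.exp_pos _))
    Finset.univ_nonempty
  have h : ∀ ω, p ω * F ω - p ω * (Real.log (p ω) - Real.log (ν ω)) - p ω * Real.log Z
      ≤ ν ω * Real.exp (F ω) / Z - p ω := fun ω => by
    rcases (hp ω).eq_or_lt with h0 | h0
    · rw [← h0]
      have := div_nonneg (mul_pos (hν ω) (Real.exp_pos (F ω))).le hZ0.le
      simpa using this
    · have hpos : 0 < ν ω * Real.exp (F ω) / (p ω * Z) :=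
        div_pos (mul_pos (hν ω) (Real.exp_pos _)) (mul_pos h0 hZ0)
      have h1 := Real.log_le_sub_one_of_pos hpos
      rw [Real.log_div (mul_pos (hν ω) (Real.exp_pos _)).ne' (mul_pos h0 hZ0).ne',
        Real.log_mul (hν ω).ne' (Real.exp_pos _).ne', Real.log_mul h0.ne' hZ0.ne',
        Real.log_exp] at h1
      have h2 := mul_le_mul_of_nonneg_left h1 h0.le
      have h3 : p ω * (ν ω * Real.exp (F ω) / (p ω * Z) - 1)
          = ν ω * Real.exp (F ω) / Z - p ω := by
        field_simp
      rw [h3] at h2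
      linarith
  have hs := Finset.sum_le_sum fun ω (_ : ω ∈ Finset.univ) => h ω
  simp only [Finset.sum_sub_distrib, ← Finset.sum_mul, ← Finset.sum_div, hp1, ← hZ,
    div_self hZ0.ne'] at hs
  rw [ent]
  linarith

lemma ent_nonneg [Nonempty Ω] {ν p : Ω → ℝ} (hν : ∀ ω, 0 < ν ω) (hν1 : ∑ ω, ν ω = 1)
    (hp : ∀ ω, 0 ≤ p ω) (hp1 : ∑ ω, p ω = 1) : 0 ≤ ent ν p := by
  simpa [hν1] using sum_mul_le_ent_add_log hν hp hp1 0

/-- The supremum in the variational formula is approached by functions equal to `log (μ / ν)`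
where `μ` has mass, and to `-N` elsewhere. -/
lemma relEntropy_eq_ent [Nonempty Ω] [MeasurableSpace Ω] [MeasurableSingletonClass Ω]
    (μ ν : Measure Ω) [IsProbabilityMeasure μ] [IsProbabilityMeasure ν]
    (hν : ∀ ω, 0 < ν.real {ω}) :
    relEntropy μ ν = ent (fun ω => ν.real {ω}) (fun ω => μ.real {ω}) := by
  classical
  have hμ1 : ∑ ω, μ.real {ω} = 1 := by simp
  have hν1 : ∑ ω, ν.real {ω} = 1 := by simp
  have hint : ∀ (κ : Measure Ω) [IsProbabilityMeasure κ] (f : Ω → ℝ),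
      ∫ ω, f ω ∂κ = ∑ ω, κ.real {ω} * f ω := fun κ _ f => by
    rw [integral_fintype .of_finite]
    rfl
  refine le_antisymm (ciSup_le fun f => ?_) ?_
  · have := sum_mul_le_ent_add_log hν (p := fun ω => μ.real {ω})
      (fun _ => measureReal_nonneg) hμ1 f
    rw [hint, hint]
    linarith
  · have hN : ∀ N : ℕ, ent (fun ω => ν.real {ω}) (fun ω => μ.real {ω})
        - Real.log (1 + Real.exp (-N)) ≤ relEntropy μ ν := fun N => by
      set f : Ω → ℝ := fun ω => if μ.real {ω} = 0 then -N else
        Real.log (μ.real {ω}) - Real.log (ν.real {ω}) with hf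
      refine le_trans ?_ (le_ciSup (relEntropy_bddAbove μ ν hν) f)
      rw [hint, hint]
      have h1 : ∑ ω, μ.real {ω} * f ω = ent (fun ω => ν.real {ω}) (fun ω => μ.real {ω}) := by
        refine Finset.sum_congr rfl fun ω _ => ?_
        by_cases h : μ.real {ω} = 0 <;> simp [hf, h]
      have h2 : ∑ ω, ν.real {ω} * Real.exp (f ω) ≤ 1 + Real.exp (-N) := by
        calc ∑ ω, ν.real {ω} * Real.exp (f ω)
            ≤ ∑ ω, (μ.real {ω} + ν.real {ω} * Real.exp (-N)) := by
              refine Finset.sum_le_sum fun ω _ => ?_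
              have hpos := hν ω
              by_cases h : μ.real {ω} = 0
              · simp [hf, h]
              · have h0 : 0 < μ.real {ω} := measureReal_nonneg.lt_of_ne' h
                simp only [hf, h, if_false]
                rw [Real.exp_sub, Real.exp_log h0, Real.exp_log hpos,
                  mul_div_cancel₀ _ hpos.ne']
                linarith [mul_pos hpos (Real.exp_pos (-(N : ℝ)))]
          _ = 1 + Real.exp (-N) := by
              rw [Finset.sum_add_distrib, ← Finset.sum_mul, hμ1, hν1, one_mul]
      have h3 : 0 < ∑ ω, ν.real {ω} * Real.exp (f ω) :=
        Finset.sum_pos (fun ω _ => mul_pos (hν ω) (Real.exp_pos _)) Finset.univ_nonempty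
      rw [h1]
      linarith [Real.log_le_log h3 h2]
    have hlim : Tendsto (fun N : ℕ => ent (fun ω => ν.real {ω}) (fun ω => μ.real {ω})
        - Real.log (1 + Real.exp (-(N : ℝ)))) atTop
        (𝓝 (ent (fun ω => ν.real {ω}) (fun ω => μ.real {ω}) - Real.log (1 + 0))) := by
      refine tendsto_const_nhds.sub (Tendsto.log (tendsto_const_nhds.add ?_) (by norm_num))
      exact Real.tendsto_exp_neg_atTop_nhds_zero.comp tendsto_natCast_atTop_atTop
    simp only [add_zero, Real.log_one, sub_zero] at hlim
    exact le_of_tendsto' hlim hN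

end Gibbs

/-! ### The voter model with stirring as a finite Markov chain -/

section Model

variable {d n : ℕ} [NeZero n]

/-- The mass of a configuration under the Bernoulli product measure. -/
def bern (d n : ℕ) [NeZero n] (ρ : ℝ) (η : Config d n) : ℝ :=
  ∏ x, if η x then ρ else 1 - ρ

lemma bern_pos {ρ : ℝ} (h0 : 0 < ρ) (h1 : ρ < 1) (η : Config d n) : 0 < bern d n ρ η :=
  Finset.prod_pos fun x _ => by split_ifs <;> linarith

/-- Integrals of product functions against the Bernoulli measure factorize. -/
lemma sum_bern_mul_prod (ρ : ℝ) (g : Torus d n → Bool → ℝ) :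
    ∑ η, bern d n ρ η * ∏ x, g x (η x) = ∏ x, (ρ * g x true + (1 - ρ) * g x false) := by
  have h := Fintype.prod_sum fun (x : Torus d n) (b : Bool) => (if b then ρ else 1 - ρ) * g x b
  simp only [Fintype.sum_bool, if_true, Bool.false_eq_true, if_false] at h
  rw [h]
  exact Finset.sum_congr rfl fun η _ => by rw [bern, Finset.prod_mul_distrib]

lemma sum_bern (ρ : ℝ) : ∑ η, bern d n ρ η = 1 := by
  simpa using sum_bern_mul_prod (d := d) (n := n) ρ fun _ _ => 1

lemma isProbabilityMeasure_bernoulli {ρ : ℝ} (h0 : 0 < ρ) (h1 : ρ < 1) :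
    IsProbabilityMeasure (ENNReal.ofReal ρ • Measure.dirac true
      + ENNReal.ofReal (1 - ρ) • Measure.dirac false) := by
  refine ⟨?_⟩
  simp only [Measure.add_apply, Measure.smul_apply, measure_univ, smul_eq_mul, mul_one]
  rw [← ENNReal.ofReal_add h0.le (by linarith)]
  simp

lemma isProbabilityMeasure_bernoulliProd {ρ : ℝ} (h0 : 0 < ρ) (h1 : ρ < 1) :
    IsProbabilityMeasure (bernoulliProd d n ρ) := by
  have := isProbabilityMeasure_bernoulli h0 h1
  unfold bernoulliProd
  infer_instance

lemma bernoulliProd_real_singleton {ρ : ℝ} (h0 : 0 < ρ) (h1 : ρ < 1) (η : Config d n) :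
    (bernoulliProd d n ρ).real {η} = bern d n ρ η := by
  have := isProbabilityMeasure_bernoulli h0 h1
  rw [Measure.real, bernoulliProd, Measure.pi_singleton, ENNReal.toReal_prod, bern]
  refine Finset.prod_congr rfl fun x _ => ?_
  cases η x
  · simp [h1.le]
  · simp [h0.le]

lemma isMarkovGen_generator {c : Fin d → LatticeConfig d → ℝ} (hc : ∀ j η, 0 ≤ c j η) {a : ℝ}
    (ha : 0 ≤ a) : IsMarkovGen (generator d n c a) where
  rate_nonneg ξ η hne := by
    have h : ∀ ζ : Config d n, 0 ≤ (Pi.single η 1 : Config d n → ℝ) ζ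
        - (Pi.single η 1 : Config d n → ℝ) ξ := fun ζ => by
      rw [Pi.single_eq_of_ne hne, sub_zero, Pi.single_apply]
      split_ifs <;> norm_num
    simp only [generator, exclusionGen, voterGen, LinearMap.add_apply, LinearMap.smul_apply,
      LinearMap.coe_mk, AddHom.coe_mk, Pi.add_apply, Pi.smul_apply, smul_eq_mul]
    refine add_nonneg (mul_nonneg (by positivity) ?_) (mul_nonneg ha ?_)
    · exact Finset.sum_nonneg fun x _ => Finset.sum_nonneg fun j _ => mul_nonneg (hc _ _) (h _)
    · exact Finset.sum_nonneg fun x _ => Finset.sum_nonneg fun j _ =>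
        mul_nonneg (sq_nonneg _) (h _)
  map_one := by
    funext η
    simp [generator, exclusionGen, voterGen]

lemma sum_real_singleton (μ : Measure (Config d n)) [IsProbabilityMeasure μ] :
    ∑ ξ, μ.real {ξ} = 1 := by simp

lemma integral_semigroup (c : Fin d → LatticeConfig d → ℝ) (a t : ℝ) (μ : Measure (Config d n))
    [IsProbabilityMeasure μ] (η : Config d n) :
    ∫ ξ, semigroup d n c a t (Pi.single η 1) ξ ∂μ
      = evolve (generator d n c a) (fun ξ => μ.real {ξ}) t η := by
  rw [integral_fintype .of_finite]
  rfl

lemma lawAt_real_singleton {c : Fin d → LatticeConfig d → ℝ} (hc : ∀ j η, 0 ≤ c j η) {a t : ℝ}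
    (ha : 0 ≤ a) (ht : 0 ≤ t) (μ : Measure (Config d n)) [IsProbabilityMeasure μ]
    (η : Config d n) :
    (lawAt c a μ t).real {η} = evolve (generator d n c a) (fun ξ => μ.real {ξ}) t η := by
  have h0 := (isMarkovGen_generator (n := n) hc ha).evolve_nonneg
    (m := fun ξ => μ.real {ξ}) (fun _ => measureReal_nonneg) ht
  rw [Measure.real, lawAt, Measure.finsetSum_apply, Finset.sum_eq_single η]
  · simp [integral_semigroup, h0 η]
  · intro ζ _ hζ
    simp [hζ]
  · simp

lemma isProbabilityMeasure_lawAt {c : Fin d → LatticeConfig d → ℝ} (hc : ∀ j η, 0 ≤ c j η)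
    {a t : ℝ} (ha : 0 ≤ a) (ht : 0 ≤ t) (μ : Measure (Config d n)) [IsProbabilityMeasure μ] :
    IsProbabilityMeasure (lawAt c a μ t) := by
  have hL := isMarkovGen_generator (n := n) hc ha
  have h0 := hL.evolve_nonneg (m := fun ξ => μ.real {ξ}) (fun _ => measureReal_nonneg) ht
  refine ⟨?_⟩
  rw [lawAt, Measure.finsetSum_apply]
  simp only [integral_semigroup, Measure.smul_apply, measure_univ, smul_eq_mul, mul_one]
  rw [← ENNReal.ofReal_sum_of_nonneg fun η _ => h0 η, hL.sum_evolve, sum_real_singleton]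
  simp

lemma entropyAt_eq_ent {c : Fin d → LatticeConfig d → ℝ} (hc : ∀ j η, 0 ≤ c j η) {a t ρ : ℝ}
    (ha : 0 ≤ a) (hρ0 : 0 < ρ) (hρ1 : ρ < 1) (ht : 0 ≤ t) (μ : Measure (Config d n))
    [IsProbabilityMeasure μ] :
    entropyAt c a ρ μ t
      = ent (bern d n ρ) (evolve (generator d n c a) (fun ξ => μ.real {ξ}) t) := by
  have := isProbabilityMeasure_lawAt hc ha ht μ
  have := isProbabilityMeasure_bernoulliProd (d := d) (n := n) hρ0 hρ1
  rw [entropyAt, relEntropy_eq_ent]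
  · congr 1
    · exact funext fun η => bernoulliProd_real_singleton hρ0 hρ1 η
    · exact funext fun η => lawAt_real_singleton hc ha ht μ η
  · exact fun η => by
      rw [bernoulliProd_real_singleton hρ0 hρ1]
      exact bern_pos hρ0 hρ1 η

lemma errorTerm_nonneg {d n : ℕ} [NeZero n] {a : ℝ} (ha : 0 ≤ a) : 0 ≤ errorTerm d n a := by
  unfold errorTerm
  have hn : (1 : ℝ) ≤ n := Nat.one_le_cast.2 NeZero.one_le
  have := Real.log_nonneg hn
  split_ifs <;> positivity

/-- The entropy bound follows from a bound of the entropy production at all mass functions. -/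
theorem entropyBound_of_production {c : Fin d → LatticeConfig d → ℝ} (hc : ∀ j η, 0 ≤ c j η)
    {a ρ C : ℝ} (ha : 0 ≤ a) (hρ0 : 0 < ρ) (hρ1 : ρ < 1)
    (hK : ∀ p : Config d n → ℝ, (∀ ξ, 0 ≤ p ξ) → ∑ ξ, p ξ = 1 →
      production (generator d n c a) (bern d n ρ) p
        ≤ C * a * (ent (bern d n ρ) p + errorTerm d n a))
    (μ : Measure (Config d n)) [IsProbabilityMeasure μ] : EntropyBound c a ρ μ C := by
  obtain ⟨h1, h2, h3⟩ := (isMarkovGen_generator (n := n) hc ha).entropy_bound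
    (bern_pos hρ0 hρ1) (m := fun ξ => μ.real {ξ}) (fun _ => measureReal_nonneg)
    (sum_real_singleton μ) (errorTerm_nonneg ha) hK
  have heq : ∀ t, 0 ≤ t → entropyAt c a ρ μ t
      = ent (bern d n ρ) (evolve (generator d n c a) (fun ξ => μ.real {ξ}) t) :=
    fun t ht => entropyAt_eq_ent hc ha hρ0 hρ1 ht μ
  refine ⟨fun t ht => ?_, ?_, fun t ht => ?_⟩
  · obtain ⟨D, hD, hD'⟩ := h1 t ht
    rw [heq t ht.le]
    refine ⟨D, hD.congr_of_eventuallyEq ?_, hD'⟩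
    filter_upwards [lt_mem_nhds ht] with s hs using heq s hs.le
  · obtain ⟨D, hD, hD'⟩ := h2
    rw [heq 0 le_rfl]
    refine ⟨D, hD.congr' ?_, hD'⟩
    filter_upwards [self_mem_nhdsWithin] with s hs
    rw [heq s (le_of_lt hs)]
  · rw [heq t ht, heq 0 le_rfl]
    exact h3 t ht

end Model

/-! ### The Hartley basis on the torus -/

section Hartley

variable {d n : ℕ} [NeZero n]

/-- `cos (2π s / n)` for a residue `s` modulo `n`. -/
def cosMod (s : ZMod n) : ℝ := (ZMod.stdAddChar s).re

/-- `sin (2π s / n)` for a residue `s` modulo `n`. -/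
def sinMod (s : ZMod n) : ℝ := (ZMod.stdAddChar s).im

lemma cosMod_add (s t : ZMod n) : cosMod (s + t) = cosMod s * cosMod t - sinMod s * sinMod t := by
  simp [cosMod, sinMod, AddChar.map_add_eq_mul]

lemma sinMod_add (s t : ZMod n) : sinMod (s + t) = sinMod s * cosMod t + cosMod s * sinMod t := by
  simp only [cosMod, sinMod, AddChar.map_add_eq_mul, Complex.mul_im]
  ring

lemma stdAddChar_neg (s : ZMod n) : ZMod.stdAddChar (-s) = star (ZMod.stdAddChar s) := by
  rw [ZMod.stdAddChar_apply, ZMod.stdAddChar_apply, AddChar.map_neg_eq_inv, Circle.coe_inv_eq_conj]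
  rfl

lemma cosMod_neg (s : ZMod n) : cosMod (-s) = cosMod s := by
  simp [cosMod, stdAddChar_neg]

lemma sinMod_neg (s : ZMod n) : sinMod (-s) = -sinMod s := by
  simp [sinMod, stdAddChar_neg]

lemma cosMod_zero : cosMod (0 : ZMod n) = 1 := by simp [cosMod]

lemma cosMod_sq_add_sinMod_sq (s : ZMod n) : cosMod s ^ 2 + sinMod s ^ 2 = 1 := by
  have h := cosMod_add s (-s)
  rw [add_neg_cancel, cosMod_neg, sinMod_neg, cosMod_zero] at h
  linarith

lemma cosMod_le_one (s : ZMod n) : cosMod s ≤ 1 := by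
  nlinarith [cosMod_sq_add_sinMod_sq s, sq_nonneg (sinMod s), sq_nonneg (cosMod s - 1)]

lemma cosMod_intCast (j : ℤ) : cosMod (j : ZMod n) = Real.cos (2 * Real.pi * j / n) := by
  have h : (2 * Real.pi * Complex.I * j / n : ℂ)
      = ((2 * Real.pi * j / n : ℝ) : ℂ) * Complex.I := by
    push_cast
    ring
  rw [cosMod, ZMod.stdAddChar_coe, h, Complex.exp_ofReal_mul_I_re]

lemma stdAddChar_sum {ι : Type*} (s : Finset ι) (f : ι → ZMod n) :
    ZMod.stdAddChar (∑ i ∈ s, f i) = ∏ i ∈ s, ZMod.stdAddChar (f i) := by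
  classical
  induction s using Finset.induction_on with
  | empty => simp
  | insert i s hi ih => rw [Finset.sum_insert hi, Finset.prod_insert hi, AddChar.map_add_eq_mul, ih]

lemma sum_stdAddChar (k : Torus d n) :
    ∑ x : Torus d n, ZMod.stdAddChar (k ⬝ᵥ x) = if k = 0 then (n : ℂ) ^ d else 0 := by
  have h1 : ∀ x : Torus d n, ZMod.stdAddChar (k ⬝ᵥ x)
      = ∏ i, (ZMod.stdAddChar (x i * k i) : ℂ) := fun x => by
    rw [dotProduct, stdAddChar_sum]
    exact Finset.prod_congr rfl fun i _ => by rw [mul_comm]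
  have h2 := Fintype.prod_sum fun (i : Fin d) (s : ZMod n) => (ZMod.stdAddChar (s * k i) : ℂ)
  simp only [h1]
  rw [← h2]
  simp only [AddChar.sum_mulShift _ (ZMod.isPrimitive_stdAddChar n), ZMod.card]
  split_ifs with h
  · simp [h]
  · obtain ⟨i, hi⟩ := Function.ne_iff.1 h
    exact Finset.prod_eq_zero (Finset.mem_univ i) (by rw [if_neg (show ¬k i = 0 from hi), Nat.cast_zero])

lemma sum_cosMod (k : Torus d n) :
    ∑ x : Torus d n, cosMod (k ⬝ᵥ x) = if k = 0 then (n : ℝ) ^ d else 0 := by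
  have h := congrArg Complex.re (sum_stdAddChar k)
  rw [Complex.re_sum] at h
  simp only [cosMod]
  rw [h]
  split_ifs
  · exact_mod_cast Complex.natCast_re (n ^ d)
  · simp

lemma sum_sinMod (k : Torus d n) : ∑ x : Torus d n, sinMod (k ⬝ᵥ x) = 0 := by
  have h := congrArg Complex.im (sum_stdAddChar k)
  rw [Complex.im_sum] at h
  simp only [sinMod]
  rw [h]
  split_ifs
  · exact_mod_cast Complex.natCast_im (n ^ d)
  · simp

/-- The Hartley functions `n^{-d/2} (cos + sin)(2π k·x / n)`. They form a real orthonormal basis of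
eigenvectors of the discrete Laplacian on the torus. -/
def hartley (k x : Torus d n) : ℝ := (cosMod (k ⬝ᵥ x) + sinMod (k ⬝ᵥ x)) / √((n : ℝ) ^ d)

lemma hartley_comm (k x : Torus d n) : hartley k x = hartley x k := by
  rw [hartley, hartley, dotProduct_comm]

lemma volume_pos : 0 < (n : ℝ) ^ d :=
  pow_pos (Nat.cast_pos.2 (NeZero.pos n)) d

lemma hartley_mul (k x y : Torus d n) : hartley k x * hartley k y
    = (cosMod (k ⬝ᵥ (x - y)) + sinMod (k ⬝ᵥ (x + y))) / (n : ℝ) ^ d := by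
  rw [hartley, hartley, div_mul_div_comm, Real.mul_self_sqrt volume_pos.le, sub_eq_add_neg,
    dotProduct_add, dotProduct_add, dotProduct_neg, cosMod_add, sinMod_add, cosMod_neg, sinMod_neg]
  ring

lemma sum_hartley_mul (x y : Torus d n) :
    ∑ k, hartley k x * hartley k y = if x = y then 1 else 0 := by
  simp only [hartley_mul, ← Finset.sum_div, Finset.sum_add_distrib]
  have h1 : ∀ z : Torus d n, ∑ k : Torus d n, cosMod (k ⬝ᵥ z)
      = if z = 0 then (n : ℝ) ^ d else 0 := fun z => by
    simp only [dotProduct_comm _ z, sum_cosMod]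
  have h2 : ∀ z : Torus d n, ∑ k : Torus d n, sinMod (k ⬝ᵥ z) = 0 := fun z => by
    simp only [dotProduct_comm _ z, sum_sinMod]
  rw [h1, h2, add_zero]
  simp only [sub_eq_zero]
  split_ifs
  · exact div_self volume_pos.ne'
  · simp

lemma sum_hartley_mul' (k l : Torus d n) :
    ∑ x, hartley k x * hartley l x = if k = l then 1 else 0 := by
  simp only [hartley_comm k, hartley_comm l, sum_hartley_mul]

/-- The eigenvalues of minus the discrete Laplacian. -/
def eig (k : Torus d n) : ℝ := ∑ j, (2 - 2 * cosMod (k j))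

lemma eig_nonneg (k : Torus d n) : 0 ≤ eig k :=
  Finset.sum_nonneg fun j _ => by linarith [cosMod_le_one (k j)]

lemma eig_neg (k : Torus d n) : eig (-k) = eig k := by
  simp [eig, cosMod_neg]

lemma hartley_add_sub (k x : Torus d n) (j : Fin d) :
    hartley k (x + Pi.single j 1) + hartley k (x - Pi.single j 1)
      = 2 * cosMod (k j) * hartley k x := by
  simp only [hartley, sub_eq_add_neg, dotProduct_add, dotProduct_neg, dotProduct_single, mul_one,
    cosMod_add, sinMod_add, cosMod_neg, sinMod_neg]
  ring

/-- The Hartley coefficients of a function on the torus. -/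
def coef (w : Torus d n → ℝ) (k : Torus d n) : ℝ := ∑ x, hartley k x * w x

lemma sum_hartley_mul_coef (w : Torus d n → ℝ) (x : Torus d n) :
    ∑ k, hartley k x * coef w k = w x := by
  simp only [coef, Finset.mul_sum, ← mul_assoc]
  rw [Finset.sum_comm]
  simp only [← Finset.sum_mul, sum_hartley_mul]
  simp

end Hartley

/-! ### The Green function of the torus -/

section Green

variable {d n : ℕ} [NeZero n]

/-- The Green function of `l - Δ` on the torus, at the origin. -/
def greenZero (d n : ℕ) [NeZero n] (l : ℝ) : ℝ :=
  (∑ k : Torus d n, 1 / (l + eig k)) / (n : ℝ) ^ d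

/-- The Green function of `l - Δ` on the torus. -/
def green (l : ℝ) (x y : Torus d n) : ℝ := ∑ k, hartley k x * hartley k y / (l + eig k)

/-- The difference of the Green function at the origin and at a nearest neighbour, see
`greenZero_sub_green`. -/
def greenStep (d n : ℕ) [NeZero n] (l : ℝ) : ℝ := (1 - l * greenZero d n l) / (2 * d)

/-- The solution `φ` of `(l - Δ) φ = w`. -/
def potential (l : ℝ) (w : Torus d n → ℝ) (x : Torus d n) : ℝ :=
  ∑ k, hartley k x * coef w k / (l + eig k)

/-- The quadratic form of `(l - Δ)⁻¹`. -/
def energy (l : ℝ) (w : Torus d n → ℝ) : ℝ := ∑ k, coef w k ^ 2 / (l + eig k)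

variable {l : ℝ}

lemma add_eig_pos (hl : 0 < l) (k : Torus d n) : 0 < l + eig k :=
  add_pos_of_pos_of_nonneg hl (eig_nonneg k)

lemma green_eq (l : ℝ) (x y : Torus d n) :
    green l x y = (∑ k : Torus d n, cosMod (k ⬝ᵥ (x - y)) / (l + eig k)) / (n : ℝ) ^ d := by
  have hodd : ∑ k : Torus d n, sinMod (k ⬝ᵥ (x + y)) / (l + eig k) = 0 := by
    have h := Equiv.sum_comp (Equiv.neg (Torus d n))
      fun k => sinMod (k ⬝ᵥ (x + y)) / (l + eig k)
    simp only [Equiv.neg_apply, neg_dotProduct, sinMod_neg, eig_neg, neg_div,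
      Finset.sum_neg_distrib] at h
    linarith
  have h : ∀ k : Torus d n, hartley k x * hartley k y / (l + eig k)
      = cosMod (k ⬝ᵥ (x - y)) / (l + eig k) / (n : ℝ) ^ d
        + sinMod (k ⬝ᵥ (x + y)) / (l + eig k) / (n : ℝ) ^ d := fun k => by
    rw [hartley_mul]
    ring
  rw [green]
  simp only [h, Finset.sum_add_distrib, ← Finset.sum_div, hodd]
  simp

lemma green_self (l : ℝ) (x : Torus d n) : green l x x = greenZero d n l := by
  simp [green_eq, greenZero, cosMod_zero]

lemma green_add_single (l : ℝ) (x : Torus d n) (j : Fin d) : green l x (x + Pi.single j 1)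
    = (∑ k : Torus d n, cosMod (k j) / (l + eig k)) / (n : ℝ) ^ d := by
  simp [green_eq, cosMod_neg]

/-- The lattice symmetries make the increment of the Green function at the origin the same in all
directions. -/
lemma greenZero_sub_green (hd : 1 ≤ d) (hl : 0 < l) (x : Torus d n) (j : Fin d) :
    greenZero d n l - green l x (x + Pi.single j 1) = greenStep d n l := by
  set s : Fin d → ℝ := fun i => ∑ k : Torus d n, (1 - cosMod (k i)) / (l + eig k) with hs
  have hsym : ∀ i, s i = s j := fun i => by
    have h := Equiv.sum_comp (Equiv.arrowCongr (Equiv.swap i j) (Equiv.refl (ZMod n)))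
      fun k : Torus d n => (1 - cosMod (k i)) / (l + eig k)
    simp only [hs]
    rw [← h]
    refine Finset.sum_congr rfl fun k _ => ?_
    have h1 : eig (Equiv.arrowCongr (Equiv.swap i j) (Equiv.refl (ZMod n)) k) = eig k := by
      simp only [eig, Equiv.arrowCongr_apply, Equiv.coe_refl, Function.comp_apply, id]
      exact Equiv.sum_comp (Equiv.swap i j).symm fun r => 2 - 2 * cosMod (k r)
    rw [h1]
    simp
  have hsum : 2 * ∑ i, s i = (n : ℝ) ^ d * (1 - l * greenZero d n l) := by
    simp only [hs]
    rw [Finset.sum_comm, Finset.mul_sum]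
    have h1 : ∀ k : Torus d n, 2 * ∑ i, (1 - cosMod (k i)) / (l + eig k)
        = 1 - l * (1 / (l + eig k)) := fun k => by
      have h2 : 2 * ∑ i, (1 - cosMod (k i)) = eig k := by
        rw [eig, Finset.mul_sum]
        exact Finset.sum_congr rfl fun i _ => by ring
      rw [← Finset.sum_div, ← mul_div_assoc, h2]
      have := (add_eig_pos hl k).ne'
      field_simp
      ring
    simp only [h1, Finset.sum_sub_distrib, ← Finset.mul_sum, greenZero]
    have := (volume_pos (d := d) (n := n)).ne'
    simp
    field_simp
  have hs' : ∑ i, s i = d * s j := by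
    rw [Finset.sum_congr rfl fun i _ => hsym i]
    simp
  have hd' : (d : ℝ) ≠ 0 := Nat.cast_ne_zero.2 (by omega)
  have hv := (volume_pos (d := d) (n := n)).ne'
  rw [green_add_single, greenZero, ← sub_div, ← Finset.sum_sub_distrib]
  simp only [← sub_div]
  rw [greenStep, div_eq_div_iff hv (by positivity)]
  rw [hs'] at hsum
  simp only [hs] at hsum
  linarith

lemma greenZero_pos (hl : 0 < l) : 0 < greenZero d n l :=
  div_pos (Finset.sum_pos (fun k _ => one_div_pos.2 (add_eig_pos hl k)) Finset.univ_nonempty)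
    volume_pos

lemma energy_nonneg (hl : 0 < l) (w : Torus d n → ℝ) : 0 ≤ energy l w :=
  Finset.sum_nonneg fun k _ => div_nonneg (sq_nonneg _) (add_eig_pos hl k).le

lemma energy_eq_sum_mul_potential (l : ℝ) (w : Torus d n → ℝ) :
    energy l w = ∑ x, w x * potential l w x := by
  simp only [energy, potential, Finset.mul_sum]
  rw [Finset.sum_comm]
  refine Finset.sum_congr rfl fun k _ => ?_
  rw [sq, mul_div_assoc]
  nth_rewrite 1 [coef]
  rw [Finset.sum_mul]
  exact Finset.sum_congr rfl fun x _ => by ring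

lemma energy_add (l : ℝ) (w h : Torus d n → ℝ) :
    energy l (w + h) = energy l w + 2 * ∑ x, h x * potential l w x + energy l h := by
  have hc : ∀ k, coef (w + h) k = coef w k + coef h k := fun k => by
    simp [coef, mul_add, Finset.sum_add_distrib]
  have h1 : ∑ x, h x * potential l w x = ∑ k, coef h k * coef w k / (l + eig k) := by
    simp only [potential, Finset.mul_sum]
    rw [Finset.sum_comm]
    refine Finset.sum_congr rfl fun k _ => ?_
    rw [mul_div_assoc]
    nth_rewrite 2 [coef]
    rw [Finset.sum_mul]
    exact Finset.sum_congr rfl fun x _ => by ring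
  rw [h1, energy, energy, energy, Finset.mul_sum, ← Finset.sum_add_distrib,
    ← Finset.sum_add_distrib]
  exact Finset.sum_congr rfl fun k _ => by rw [hc]; ring

lemma potential_equation (hl : 0 < l) (w : Torus d n → ℝ) (x : Torus d n) :
    l * potential l w x - ∑ j, (potential l w (x + Pi.single j 1)
      + potential l w (x - Pi.single j 1) - 2 * potential l w x) = w x := by
  have h1 : ∀ j : Fin d, potential l w (x + Pi.single j 1)
      + potential l w (x - Pi.single j 1) - 2 * potential l w x
      = -∑ k, (2 - 2 * cosMod (k j)) * (hartley k x * coef w k / (l + eig k)) := fun j => by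
    simp only [potential]
    rw [Finset.mul_sum, ← Finset.sum_add_distrib, ← Finset.sum_sub_distrib,
      ← Finset.sum_neg_distrib]
    refine Finset.sum_congr rfl fun k _ => ?_
    have := hartley_add_sub k x j
    linear_combination coef w k / (l + eig k) * this
  simp only [h1, Finset.sum_neg_distrib, sub_neg_eq_add]
  rw [Finset.sum_comm, ← sum_hartley_mul_coef w x, potential, Finset.mul_sum,
    ← Finset.sum_add_distrib]
  refine Finset.sum_congr rfl fun k _ => ?_
  rw [← Finset.sum_mul]
  change l * _ + eig k * _ = _
  have := (add_eig_pos hl k).ne'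
  field_simp

lemma sum_diff_mul_diff (f g : Torus d n → ℝ) (e : Torus d n) :
    ∑ x, (f (x + e) - f x) * (g (x + e) - g x)
      = -∑ x, f x * (g (x + e) + g (x - e) - 2 * g x) := by
  have h1 := Equiv.sum_comp (Equiv.addRight e) fun x => f x * (g x - g (x - e))
  simp only [Equiv.coe_addRight, add_sub_cancel_right] at h1
  have h2 : ∑ x, (f (x + e) - f x) * (g (x + e) - g x)
      = ∑ x, f (x + e) * (g (x + e) - g x) - ∑ x, f x * (g (x + e) - g x) := by
    rw [← Finset.sum_sub_distrib]
    exact Finset.sum_congr rfl fun x _ => by ring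
  rw [h2, h1, ← Finset.sum_sub_distrib, ← Finset.sum_neg_distrib]
  exact Finset.sum_congr rfl fun x _ => by ring

lemma sum_grad_mul_grad_potential (hl : 0 < l) (w f : Torus d n → ℝ) :
    ∑ x, ∑ j, (f (x + Pi.single j 1) - f x)
        * (potential l w (x + Pi.single j 1) - potential l w x)
      = ∑ x, f x * w x - l * ∑ x, f x * potential l w x := by
  rw [Finset.sum_comm]
  simp only [sum_diff_mul_diff f (potential l w)]
  rw [Finset.sum_neg_distrib, Finset.sum_comm, Finset.mul_sum, ← Finset.sum_sub_distrib,
    ← Finset.sum_neg_distrib]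
  refine Finset.sum_congr rfl fun x _ => ?_
  rw [← Finset.mul_sum]
  linear_combination f x * potential_equation hl w x

lemma sum_grad_potential_sq_le (hl : 0 < l) (w : Torus d n → ℝ) :
    ∑ x, ∑ j, (potential l w (x + Pi.single j 1) - potential l w x) ^ 2 ≤ energy l w := by
  have h := sum_grad_mul_grad_potential hl w (potential l w)
  simp only [← sq] at h
  rw [h, energy_eq_sum_mul_potential]
  simp only [mul_comm (w _)]
  have : 0 ≤ l * ∑ x, potential l w x ^ 2 :=
    mul_nonneg hl.le (Finset.sum_nonneg fun x _ => sq_nonneg _)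
  linarith

lemma energy_bond (hd : 1 ≤ d) (hl : 0 < l) (x : Torus d n) (j : Fin d) :
    energy l (Pi.single x 1 - Pi.single (x + Pi.single j 1) 1 : Torus d n → ℝ)
      = 2 * greenStep d n l := by
  have hc : ∀ k, coef (Pi.single x 1 - Pi.single (x + Pi.single j 1) 1 : Torus d n → ℝ) k
      = hartley k x - hartley k (x + Pi.single j 1) := fun k => by
    simp [coef, mul_sub, Pi.single_apply]
  have h : energy l (Pi.single x 1 - Pi.single (x + Pi.single j 1) 1 : Torus d n → ℝ)
      = green l x x + green l (x + Pi.single j 1) (x + Pi.single j 1)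
        - 2 * green l x (x + Pi.single j 1) := by
    simp only [energy, green]
    rw [Finset.mul_sum, ← Finset.sum_add_distrib, ← Finset.sum_sub_distrib]
    exact Finset.sum_congr rfl fun k _ => by rw [hc]; ring
  rw [h, green_self, green_self]
  linarith [greenZero_sub_green hd hl x j]

end Green

/-! ### Exponential moments of the energy -/

section Moments

variable {d n : ℕ} [NeZero n]

/-- The centred opinions `ω_x = η_x - ρ`. -/
def centered {d n : ℕ} (ρ : ℝ) (η : Config d n) (x : Torus d n) : ℝ := occ (η x) - ρ

/-- A centred Bernoulli variable is sub-Gaussian; the proof compares it with its symmetrization. -/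
lemma bernoulli_mgf_le {ρ : ℝ} (h0 : 0 < ρ) (h1 : ρ < 1) (s : ℝ) :
    ρ * Real.exp (s * (1 - ρ)) + (1 - ρ) * Real.exp (s * (0 - ρ)) ≤ Real.exp (s ^ 2 / 2) := by
  have h1' : 0 < 1 - ρ := by linarith
  set M := ρ * Real.exp (s * (1 - ρ)) + (1 - ρ) * Real.exp (s * (0 - ρ)) with hM
  have hM0 : 0 ≤ M := by positivity
  set M' := ρ * Real.exp (-(s * (1 - ρ))) + (1 - ρ) * Real.exp (-(s * (0 - ρ))) with hM'
  have hM1 : 1 ≤ M' := by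
    have e1 := mul_le_mul_of_nonneg_left (Real.add_one_le_exp (-(s * (1 - ρ)))) h0.le
    have e2 := mul_le_mul_of_nonneg_left (Real.add_one_le_exp (-(s * (0 - ρ)))) h1'.le
    linarith
  have hprod : M * M' = ρ ^ 2 + (1 - ρ) ^ 2 + 2 * ρ * (1 - ρ) * Real.cosh s := by
    have e1 : Real.exp (s * (1 - ρ)) * Real.exp (-(s * (1 - ρ))) = 1 := by
      rw [← Real.exp_add, add_neg_cancel, Real.exp_zero]
    have e2 : Real.exp (s * (0 - ρ)) * Real.exp (-(s * (0 - ρ))) = 1 := by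
      rw [← Real.exp_add, add_neg_cancel, Real.exp_zero]
    have e3 : Real.exp (s * (1 - ρ)) * Real.exp (-(s * (0 - ρ))) = Real.exp s := by
      rw [← Real.exp_add]
      ring_nf
    have e4 : Real.exp (s * (0 - ρ)) * Real.exp (-(s * (1 - ρ))) = Real.exp (-s) := by
      rw [← Real.exp_add]
      ring_nf
    rw [Real.cosh_eq, hM, hM']
    linear_combination ρ ^ 2 * e1 + (1 - ρ) ^ 2 * e2 + ρ * (1 - ρ) * (e3 + e4)
  have hcosh := Real.one_le_cosh s
  -- Jensen's inequality gives `M' ≥ 1` for the independent copy with opposite sign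
  have h2 : M ≤ M * M' := le_mul_of_one_le_right hM0 hM1
  have h3 := Real.cosh_le_exp_half_sq s
  have h4 : 0 ≤ ρ ^ 2 + (1 - ρ) ^ 2 := by positivity
  have h5 : ρ ^ 2 + (1 - ρ) ^ 2 ≤ (ρ ^ 2 + (1 - ρ) ^ 2) * Real.cosh s :=
    le_mul_of_one_le_right h4 hcosh
  have h6 : (ρ ^ 2 + (1 - ρ) ^ 2) * Real.cosh s + 2 * ρ * (1 - ρ) * Real.cosh s = Real.cosh s := by
    ring
  linarith

lemma sum_bern_mul_exp_le {ρ : ℝ} (h0 : 0 < ρ) (h1 : ρ < 1) (h : Torus d n → ℝ) :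
    ∑ η, bern d n ρ η * Real.exp (∑ x, h x * centered ρ η x)
      ≤ Real.exp (∑ x, h x ^ 2 / 2) := by
  have e1 := sum_bern_mul_prod (d := d) (n := n) ρ fun x b => Real.exp (h x * (occ b - ρ))
  simp only [Real.exp_sum, centered]
  rw [e1]
  refine Finset.prod_le_prod (fun x _ => ?_) fun x _ => ?_
  · have : 0 < 1 - ρ := by linarith
    positivity
  · simpa [occ] using bernoulli_mgf_le h0 h1 (h x)

open ProbabilityTheory in
lemma integral_exp_sq_gaussianReal_le {b : ℝ} (hb0 : 0 ≤ b) (hb : b ≤ 1 / 2) :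
    Integrable (fun g => Real.exp (b * g ^ 2 / 2)) (gaussianReal 0 1) ∧
      ∫ g, Real.exp (b * g ^ 2 / 2) ∂gaussianReal 0 1 ≤ Real.exp b := by
  have hb1 : 0 < 1 - b := by linarith
  have hval : ∫ g, Real.exp (b * g ^ 2 / 2) ∂gaussianReal 0 1 = √(1 / (1 - b)) := by
    rw [integral_gaussianReal_eq_integral_smul one_ne_zero]
    have h1 : ∀ x : ℝ, gaussianPDFReal 0 1 x • Real.exp (b * x ^ 2 / 2)
        = (√(2 * Real.pi))⁻¹ * Real.exp (-((1 - b) / 2) * x ^ 2) := fun x => by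
      rw [gaussianPDFReal, smul_eq_mul, mul_assoc, ← Real.exp_add]
      simp only [NNReal.coe_one, mul_one, sub_zero]
      congr 2
      ring
    simp only [h1]
    rw [integral_const_mul, integral_gaussian, ← Real.sqrt_inv, ← Real.sqrt_mul (by positivity)]
    congr 1
    have := Real.pi_pos
    field_simp
  refine ⟨Integrable.of_integral_ne_zero ?_, ?_⟩
  · rw [hval]
    positivity
  · rw [hval]
    refine Real.sqrt_le_iff.2 ⟨(Real.exp_pos _).le, ?_⟩
    rw [← Real.exp_nat_mul, div_le_iff₀ hb1]
    have h2 := Real.add_one_le_exp (((2 : ℕ) : ℝ) * b)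
    push_cast at h2 ⊢
    nlinarith

open ProbabilityTheory in
/-- The exponential moment of a nonnegative quadratic form of independent centred Bernoulli
variables, diagonal in the Hartley basis with eigenvalues at most `1/2`. The square is linearized
by independent Gaussian variables (the Hubbard-Stratonovich transformation), the mean over the
opinions is bounded by sub-Gaussianity, and orthonormality of the basis makes the remaining
Gaussian integral a product. -/
lemma sum_bern_mul_exp_quadratic_le {ρ : ℝ} (h0 : 0 < ρ) (h1 : ρ < 1) (b : Torus d n → ℝ)
    (hb0 : ∀ k, 0 ≤ b k) (hb : ∀ k, b k ≤ 1 / 2) :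
    ∑ η, bern d n ρ η * Real.exp (∑ k, b k * coef (centered ρ η) k ^ 2 / 2)
      ≤ Real.exp (∑ k, b k) := by
  set G : Measure (Torus d n → ℝ) := Measure.pi fun _ => gaussianReal 0 1 with hG
  have hlin : ∀ η : Config d n, Real.exp (∑ k, b k * coef (centered ρ η) k ^ 2 / 2)
      = ∫ g, ∏ k, Real.exp (√(b k) * coef (centered ρ η) k * g k) ∂G := fun η => by
    rw [hG, integral_fintype_prod_eq_prod
      (fun k (y : ℝ) => Real.exp (√(b k) * coef (centered ρ η) k * y)), Real.exp_sum]
    refine Finset.prod_congr rfl fun k _ => ?_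
    have h := congrFun (mgf_id_gaussianReal (μ := 0) (v := 1)) (√(b k) * coef (centered ρ η) k)
    simp only [mgf, id] at h
    rw [h, mul_pow, Real.sq_sqrt (hb0 k)]
    congr 1
    simp
  have hint : ∀ η : Config d n,
      Integrable (fun g => ∏ k, Real.exp (√(b k) * coef (centered ρ η) k * g k)) G := fun η =>
    Integrable.fintype_prod (f := fun k (y : ℝ) => Real.exp (√(b k) * coef (centered ρ η) k * y))
      fun k => integrable_exp_mul_gaussianReal _
  have hint2 : Integrable (fun g => ∏ k, Real.exp (b k * g k ^ 2 / 2)) G :=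
    Integrable.fintype_prod (f := fun k (y : ℝ) => Real.exp (b k * y ^ 2 / 2))
      fun k => (integral_exp_sq_gaussianReal_le (hb0 k) (hb k)).1
  simp only [hlin, ← integral_const_mul]
  rw [← integral_finsetSum _ fun η _ => (hint η).const_mul _]
  calc ∫ g, ∑ η, bern d n ρ η * ∏ k, Real.exp (√(b k) * coef (centered ρ η) k * g k) ∂G
      ≤ ∫ g, ∏ k, Real.exp (b k * g k ^ 2 / 2) ∂G := by
        refine integral_mono (integrable_finsetSum _ fun η _ => (hint η).const_mul _) hint2
          fun g => ?_
        set h : Torus d n → ℝ := fun x => ∑ k, √(b k) * g k * hartley k x with hh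
        have e1 : ∀ η : Config d n, ∏ k, Real.exp (√(b k) * coef (centered ρ η) k * g k)
            = Real.exp (∑ x, h x * centered ρ η x) := fun η => by
          rw [← Real.exp_sum]
          congr 1
          simp only [hh, coef, Finset.sum_mul, Finset.mul_sum]
          rw [Finset.sum_comm]
          exact Finset.sum_congr rfl fun x _ => Finset.sum_congr rfl fun k _ => by ring
        have e2 : ∑ x, h x ^ 2 / 2 = ∑ k, b k * g k ^ 2 / 2 := by
          rw [← Finset.sum_div, ← Finset.sum_div]
          congr 1
          have e3 : ∀ x, h x ^ 2 = ∑ k, ∑ k', (√(b k) * g k) * (√(b k') * g k')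
              * (hartley k x * hartley k' x) := fun x => by
            rw [sq, hh, Finset.sum_mul_sum]
            exact Finset.sum_congr rfl fun k _ => Finset.sum_congr rfl fun k' _ => by ring
          simp only [e3]
          rw [Finset.sum_comm]
          refine Finset.sum_congr rfl fun k _ => ?_
          rw [Finset.sum_comm]
          simp only [← Finset.mul_sum, sum_hartley_mul']
          simp only [mul_ite, mul_one, mul_zero, Finset.sum_ite_eq, Finset.mem_univ, if_true]
          linear_combination g k ^ 2 * Real.mul_self_sqrt (hb0 k)
        simp only [e1]
        refine (sum_bern_mul_exp_le h0 h1 h).trans ?_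
        rw [e2, Real.exp_sum]
    _ = ∏ k, ∫ y, Real.exp (b k * y ^ 2 / 2) ∂gaussianReal 0 1 := by
        rw [hG, integral_fintype_prod_eq_prod (fun k (y : ℝ) => Real.exp (b k * y ^ 2 / 2))]
    _ ≤ Real.exp (∑ k, b k) := by
        rw [Real.exp_sum]
        exact Finset.prod_le_prod (fun k _ => integral_nonneg fun y => (Real.exp_pos _).le)
          fun k _ => (integral_exp_sq_gaussianReal_le (hb0 k) (hb k)).2

/-- The mean energy is controlled by the entropy and the Green function at the origin. -/
lemma sum_mul_energy_le {ρ : ℝ} (h0 : 0 < ρ) (h1 : ρ < 1) {l : ℝ} (hl : 0 < l)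
    {p : Config d n → ℝ} (hp : ∀ η, 0 ≤ p η) (hp1 : ∑ η, p η = 1) :
    l * ∑ η, p η * energy l (centered ρ η)
      ≤ 4 * ent (bern d n ρ) p + 2 * (l * (n : ℝ) ^ d * greenZero d n l) := by
  have h2 := sum_mul_le_ent_add_log (bern_pos h0 h1) hp hp1
    fun η => ∑ k, (l / (2 * (l + eig k))) * coef (centered ρ η) k ^ 2 / 2
  have h3 : ∀ k : Torus d n, l / (2 * (l + eig k)) ≤ 1 / 2 := fun k => by
    have := add_eig_pos hl k
    rw [div_le_div_iff₀ (by positivity) (by norm_num)]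
    linarith [eig_nonneg k]
  have h4 := sum_bern_mul_exp_quadratic_le h0 h1 (fun k : Torus d n => l / (2 * (l + eig k)))
    (fun k => div_nonneg hl.le (by linarith [add_eig_pos hl k])) h3
  have h5 : 0 < ∑ η, bern d n ρ η
      * Real.exp (∑ k, (l / (2 * (l + eig k))) * coef (centered ρ η) k ^ 2 / 2) :=
    Finset.sum_pos (fun η _ => mul_pos (bern_pos h0 h1 η) (Real.exp_pos _)) Finset.univ_nonempty
  have h6 := Real.log_le_log h5 h4
  rw [Real.log_exp] at h6
  have e1 : ∑ k : Torus d n, l / (2 * (l + eig k)) = l * (n : ℝ) ^ d * greenZero d n l / 2 := by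
    rw [greenZero, mul_assoc, mul_div_cancel₀ _ volume_pos.ne', mul_div_assoc, Finset.sum_div,
      Finset.mul_sum]
    refine Finset.sum_congr rfl fun k _ => ?_
    have := (add_eig_pos hl k).ne'
    field_simp
  have e2 : ∀ η : Config d n, ∑ k, (l / (2 * (l + eig k))) * coef (centered ρ η) k ^ 2 / 2
      = l * energy l (centered ρ η) / 4 := fun η => by
    rw [energy, Finset.mul_sum, Finset.sum_div]
    refine Finset.sum_congr rfl fun k _ => ?_
    have := (add_eig_pos hl k).ne'
    field_simp
    ring
  simp only [e2] at h2 h6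
  rw [e1] at h6
  have e3 : ∑ η, p η * (l * energy l (centered ρ η) / 4)
      = l * (∑ η, p η * energy l (centered ρ η)) / 4 := by
    rw [Finset.mul_sum, Finset.sum_div]
    exact Finset.sum_congr rfl fun η _ => by ring
  rw [e3] at h2
  linarith

end Moments

/-! ### Integration by parts against the exchange dynamics -/

section Exchange

variable {d n : ℕ} [NeZero n]

lemma exchange_exchange {d n : ℕ} (x y : Torus d n) (η : Config d n) :
    exchange x y (exchange x y η) = η := by
  funext z
  simp [exchange]

/-- The exchange of two opinions, as a permutation of the configurations. -/
def exchangeEquiv (x y : Torus d n) : Config d n ≃ Config d n where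
  toFun := exchange x y
  invFun := exchange x y
  left_inv := exchange_exchange x y
  right_inv := exchange_exchange x y

lemma bern_exchange (ρ : ℝ) (x y : Torus d n) (η : Config d n) :
    bern d n ρ (exchange x y η) = bern d n ρ η :=
  Equiv.prod_comp (Equiv.swap x y) fun z => if η z then ρ else 1 - ρ

lemma sum_comp_exchange (x y : Torus d n) (G : Config d n → ℝ) :
    ∑ η, G (exchange x y η) = ∑ η, G η :=
  Equiv.sum_comp (exchangeEquiv x y) G

/-- The Dirichlet form of the exchange dynamics with unit rates (each bond counted once). -/
def dirichlet (ρ : ℝ) (g : Config d n → ℝ) : ℝ :=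
  ∑ x, ∑ j, ∑ η, bern d n ρ η * (g (exchange x (x + Pi.single j 1) η) - g η) ^ 2

lemma sum_mul_sub_exchange_le {ρ : ℝ} (h0 : 0 < ρ) (h1 : ρ < 1) (x y : Torus d n)
    (F : Config d n → ℝ) {p g : Config d n → ℝ} (hg : ∀ η, bern d n ρ η * g η ^ 2 = p η) {A : ℝ}
    (hA : 0 < A) :
    ∑ η, p η * (F η - F (exchange x y η))
      ≤ A / 2 * ∑ η, bern d n ρ η * (g (exchange x y η) - g η) ^ 2
        + 1 / (2 * A) * ∑ η, p η * (F η - F (exchange x y η)) ^ 2 := by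
  set σ := exchange x y with hσ
  have hp : ∀ η, p (σ η) = bern d n ρ η * g (σ η) ^ 2 := fun η => by
    rw [← hg, hσ, bern_exchange]
  have e1 : ∑ η, p η * (F η - F (σ η)) = ∑ η, p (σ η) * (F (σ η) - F η) := by
    rw [← sum_comp_exchange x y fun η => p η * (F η - F (σ η))]
    simp only [hσ, exchange_exchange]
  have e2 : ∑ η, p η * (F η - F (σ η)) ^ 2 = ∑ η, p (σ η) * (F η - F (σ η)) ^ 2 := by
    rw [← sum_comp_exchange x y fun η => p η * (F η - F (σ η)) ^ 2]
    simp only [hσ, exchange_exchange]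
    exact Finset.sum_congr rfl fun η _ => by ring
  have key : ∑ η, (p η * (F η - F (σ η)) + p (σ η) * (F (σ η) - F η))
      ≤ ∑ η, (A * (bern d n ρ η * (g (σ η) - g η) ^ 2)
        + 1 / (2 * A) * (p η * (F η - F (σ η)) ^ 2 + p (σ η) * (F η - F (σ η)) ^ 2)) := by
    refine Finset.sum_le_sum fun η _ => ?_
    rw [hp, ← hg η]
    set D := F η - F (σ η)
    have hν := (bern_pos h0 h1 η).le
    have hD : F (σ η) - F η = -D := by ring
    rw [hD]
    set u := g η
    set v := g (σ η)
    have h2 : (u ^ 2 - v ^ 2) * D ≤ A * (v - u) ^ 2 + 1 / (2 * A) * ((u ^ 2 + v ^ 2) * D ^ 2) := by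
      have h3 : A * (v - u) ^ 2 + 1 / (2 * A) * ((u ^ 2 + v ^ 2) * D ^ 2) - (u ^ 2 - v ^ 2) * D
          = A * (v - u + (u + v) * D / (2 * A)) ^ 2 + (u - v) ^ 2 * D ^ 2 / (4 * A) := by
        field_simp
        ring
      have h4 : 0 ≤ A * (v - u + (u + v) * D / (2 * A)) ^ 2 + (u - v) ^ 2 * D ^ 2 / (4 * A) := by
        positivity
      linarith
    have h5 := mul_le_mul_of_nonneg_left h2 hν
    linarith
  simp only [Finset.sum_add_distrib, ← Finset.mul_sum] at key
  rw [← e1, ← e2] at key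
  have h6 : 1 / (2 * A) * (∑ η, p η * (F η - F (σ η)) ^ 2 + ∑ η, p η * (F η - F (σ η)) ^ 2)
      = 2 * (1 / (2 * A) * ∑ η, p η * (F η - F (σ η)) ^ 2) := by ring
  rw [h6] at key
  linarith

/-- The sum of `ω_x ω_y` over the nearest neighbour bonds of the torus, `ω` being the centred
opinions. -/
def interaction (ρ : ℝ) (η : Config d n) : ℝ :=
  ∑ x, ∑ j, centered ρ η x * centered ρ η (x + Pi.single j 1)

lemma centered_exchange {d n : ℕ} (ρ : ℝ) (x y : Torus d n) (η : Config d n) :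
    centered ρ (exchange x y η) = centered ρ η
      + (centered ρ η y - centered ρ η x) • (Pi.single x 1 - Pi.single y 1) := by
  funext z
  simp only [centered, exchange, Pi.add_apply, Pi.smul_apply, Pi.sub_apply, smul_eq_mul,
    Pi.single_apply, Equiv.swap_apply_def]
  split_ifs with h1 h2 <;> simp_all

lemma energy_smul (l r : ℝ) (w : Torus d n → ℝ) : energy l (r • w) = r ^ 2 * energy l w := by
  simp only [energy, coef, Finset.mul_sum, Pi.smul_apply, smul_eq_mul]
  refine Finset.sum_congr rfl fun k _ => ?_
  have : ∑ x, hartley k x * (r * w x) = r * ∑ x, hartley k x * w x := by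
    rw [Finset.mul_sum]
    exact Finset.sum_congr rfl fun x _ => by ring
  rw [this]
  ring

lemma energy_exchange (hd : 1 ≤ d) {l : ℝ} (hl : 0 < l) (ρ : ℝ) (x : Torus d n) (j : Fin d)
    (η : Config d n) :
    energy l (centered ρ (exchange x (x + Pi.single j 1) η)) - energy l (centered ρ η)
      = -2 * ((centered ρ η (x + Pi.single j 1) - centered ρ η x)
          * (potential l (centered ρ η) (x + Pi.single j 1) - potential l (centered ρ η) x))
        + 2 * greenStep d n l
          * (centered ρ η (x + Pi.single j 1) - centered ρ η x) ^ 2 := by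
  rw [centered_exchange, energy_add, energy_smul, energy_bond hd hl]
  have h : ∑ z, ((centered ρ η (x + Pi.single j 1) - centered ρ η x) •
      (Pi.single x 1 - Pi.single (x + Pi.single j 1) 1 : Torus d n → ℝ)) z
        * potential l (centered ρ η) z
      = (centered ρ η (x + Pi.single j 1) - centered ρ η x)
        * (potential l (centered ρ η) x - potential l (centered ρ η) (x + Pi.single j 1)) := by
    simp only [Pi.smul_apply, Pi.sub_apply, smul_eq_mul, Pi.single_apply, mul_assoc,
      ← Finset.mul_sum, sub_mul, Finset.sum_sub_distrib]
    simp
  rw [h]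
  ring

/-- The exchange generator with unit rates, applied to half the energy, produces the
interaction: the lattice Laplacian acts on the Green function except across the diagonal. -/
lemma two_mul_greenStep_mul_interaction (hd : 1 ≤ d) {l : ℝ} (hl : 0 < l) (ρ : ℝ)
    (η : Config d n) :
    2 * greenStep d n l * interaction ρ η = l * energy l (centered ρ η)
      - l * greenZero d n l * ∑ x, centered ρ η x ^ 2
      + ∑ x, ∑ j, (energy l (centered ρ η) / 2
        - energy l (centered ρ (exchange x (x + Pi.single j 1) η)) / 2) := by
  set w := centered ρ η with hw
  have h1 : ∀ x (j : Fin d), energy l w / 2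
      - energy l (centered ρ (exchange x (x + Pi.single j 1) η)) / 2
      = (w (x + Pi.single j 1) - w x)
          * (potential l w (x + Pi.single j 1) - potential l w x)
        - greenStep d n l * (w (x + Pi.single j 1) - w x) ^ 2 := fun x j => by
    linear_combination -(1 / 2) * energy_exchange hd hl ρ x j η
  simp only [h1, Finset.sum_sub_distrib, ← Finset.mul_sum]
  rw [sum_grad_mul_grad_potential hl, ← energy_eq_sum_mul_potential]
  have h2 : ∑ x, ∑ j : Fin d, (w (x + Pi.single j 1) - w x) ^ 2
      = 2 * d * ∑ x, w x ^ 2 - 2 * interaction ρ η := by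
    have h3 : ∀ j : Fin d, ∑ x, (w (x + Pi.single j 1) - w x) ^ 2
        = 2 * ∑ x, w x ^ 2 - 2 * ∑ x, w x * w (x + Pi.single j 1) := fun j => by
      have h4 := Equiv.sum_comp (Equiv.addRight (Pi.single j (1 : ZMod n)))
        fun x : Torus d n => w x ^ 2
      simp only [Equiv.coe_addRight] at h4
      have h5 : ∀ x, (w (x + Pi.single j 1) - w x) ^ 2 = w (x + Pi.single j 1) ^ 2 + w x ^ 2
          - 2 * (w x * w (x + Pi.single j 1)) := fun x => by ring
      simp only [h5, Finset.sum_sub_distrib, Finset.sum_add_distrib, h4, ← Finset.mul_sum]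
      ring
    rw [Finset.sum_comm, interaction, Finset.sum_comm (f := fun x j => centered ρ η x * _)]
    simp only [h3, Finset.sum_sub_distrib, ← Finset.mul_sum]
    simp only [Finset.sum_const, Finset.card_univ, Fintype.card_fin, nsmul_eq_mul]
    ring
  rw [h2]
  have h3 : 2 * (d : ℝ) * greenStep d n l = 1 - l * greenZero d n l := by
    have : (d : ℝ) ≠ 0 := Nat.cast_ne_zero.2 (by omega)
    rw [greenStep]
    field_simp
  have h4 : ∑ x, w x * w x = ∑ x, w x ^ 2 := Finset.sum_congr rfl fun x _ => (sq _).symm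
  rw [h4]
  linear_combination (∑ x, w x ^ 2) * h3

/-- The mean interaction is controlled by the Dirichlet form and the mean energy. -/
lemma interaction_le (hd : 1 ≤ d) {l : ℝ} (hl : 0 < l) {ρ : ℝ} (h0 : 0 < ρ) (h1 : ρ < 1)
    {p g : Config d n → ℝ} (hp1 : ∑ η, p η = 1) (hg : ∀ η, bern d n ρ η * g η ^ 2 = p η) {A : ℝ}
    (hA : 0 < A) :
    2 * greenStep d n l * ∑ η, p η * interaction ρ η
      ≤ A / 2 * dirichlet ρ g + l * ∑ η, p η * energy l (centered ρ η)
        + 1 / A * (∑ η, p η * energy l (centered ρ η) + d * (n : ℝ) ^ d * greenStep d n l ^ 2) := by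
  have hp : ∀ η, 0 ≤ p η := fun η => by
    rw [← hg]
    exact mul_nonneg (bern_pos h0 h1 η).le (sq_nonneg _)
  set F : Config d n → ℝ := fun η => energy l (centered ρ η) / 2 with hF
  set κ := greenStep d n l with hκ
  have hsq : ∀ η, ∑ x, ∑ j : Fin d, (F η - F (exchange x (x + Pi.single j 1) η)) ^ 2
      ≤ 2 * energy l (centered ρ η) + 2 * (d * (n : ℝ) ^ d * κ ^ 2) := fun η => by
    set w := centered ρ η with hw
    have h2 : ∀ x (j : Fin d), (F η - F (exchange x (x + Pi.single j 1) η)) ^ 2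
        ≤ 2 * (potential l w (x + Pi.single j 1) - potential l w x) ^ 2 + 2 * κ ^ 2 :=
      fun x j => by
        have h3 : F η - F (exchange x (x + Pi.single j 1) η)
            = (w (x + Pi.single j 1) - w x)
              * (potential l w (x + Pi.single j 1) - potential l w x)
            - κ * (w (x + Pi.single j 1) - w x) ^ 2 := by
          simp only [hF]
          linear_combination -(1 / 2) * energy_exchange hd hl ρ x j η
        rw [h3]
        -- the difference of two opinions is `-1`, `0` or `1`
        have h4 : ∀ b b' : Bool, occ b - occ b' = -1 ∨ occ b - occ b' = 0 ∨
            occ b - occ b' = 1 := by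
          intro b b'
          cases b <;> cases b' <;> simp [occ]
        have h5 : w (x + Pi.single j 1) - w x
            = occ (η (x + Pi.single j 1)) - occ (η x) := by
          simp only [hw, centered]
          ring
        rw [h5]
        set P := potential l w (x + Pi.single j 1) - potential l w x
        rcases h4 (η (x + Pi.single j 1)) (η x) with h | h | h <;> rw [h] <;>
          nlinarith [sq_nonneg (P + κ), sq_nonneg (P - κ)]
    calc ∑ x, ∑ j : Fin d, (F η - F (exchange x (x + Pi.single j 1) η)) ^ 2
        ≤ ∑ x, ∑ j : Fin d,
          (2 * (potential l w (x + Pi.single j 1) - potential l w x) ^ 2 + 2 * κ ^ 2) :=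
          Finset.sum_le_sum fun x _ => Finset.sum_le_sum fun j _ => h2 x j
      _ = 2 * ∑ x, ∑ j : Fin d, (potential l w (x + Pi.single j 1) - potential l w x) ^ 2
          + 2 * (d * (n : ℝ) ^ d * κ ^ 2) := by
          simp only [Finset.sum_add_distrib, ← Finset.mul_sum]
          simp
          ring
      _ ≤ _ := by linarith [sum_grad_potential_sq_le hl w]
  have hstep : 2 * κ * ∑ η, p η * interaction ρ η
      ≤ l * ∑ η, p η * energy l (centered ρ η)
        + ∑ x, ∑ j : Fin d, ∑ η, p η * (F η - F (exchange x (x + Pi.single j 1) η)) := by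
    have h2 : ∀ η, p η * (2 * κ * interaction ρ η) ≤ p η * (l * energy l (centered ρ η)
        + ∑ x, ∑ j : Fin d, (F η - F (exchange x (x + Pi.single j 1) η))) := fun η => by
      refine mul_le_mul_of_nonneg_left ?_ (hp η)
      rw [two_mul_greenStep_mul_interaction hd hl]
      have : 0 ≤ l * greenZero d n l * ∑ x, centered ρ η x ^ 2 :=
        mul_nonneg (mul_nonneg hl.le (greenZero_pos hl).le)
          (Finset.sum_nonneg fun x _ => sq_nonneg _)
      simp only [hF]
      linarith
    have h3 := Finset.sum_le_sum fun η (_ : η ∈ Finset.univ) => h2 η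
    have e1 : ∑ η, p η * (2 * κ * interaction ρ η) = 2 * κ * ∑ η, p η * interaction ρ η := by
      rw [Finset.mul_sum]
      exact Finset.sum_congr rfl fun η _ => by ring
    have e2 : ∑ η, p η * (l * energy l (centered ρ η)
        + ∑ x, ∑ j : Fin d, (F η - F (exchange x (x + Pi.single j 1) η)))
        = l * ∑ η, p η * energy l (centered ρ η)
        + ∑ x, ∑ j : Fin d, ∑ η, p η * (F η - F (exchange x (x + Pi.single j 1) η)) := by
      simp only [mul_add, Finset.sum_add_distrib, Finset.mul_sum]
      congr 1
      · exact Finset.sum_congr rfl fun η _ => by ring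
      · rw [Finset.sum_comm]
        exact Finset.sum_congr rfl fun x _ => Finset.sum_comm
    rwa [e1, e2] at h3
  have hbond : ∑ x, ∑ j : Fin d, ∑ η, p η * (F η - F (exchange x (x + Pi.single j 1) η))
      ≤ A / 2 * dirichlet ρ g + 1 / (2 * A) * ∑ x, ∑ j : Fin d,
        ∑ η, p η * (F η - F (exchange x (x + Pi.single j 1) η)) ^ 2 := by
    rw [dirichlet]
    simp only [Finset.mul_sum, ← Finset.sum_add_distrib]
    refine Finset.sum_le_sum fun x _ => Finset.sum_le_sum fun j _ => ?_
    have := sum_mul_sub_exchange_le h0 h1 x (x + Pi.single j 1) F hg hA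
    simpa only [Finset.mul_sum, ← Finset.sum_add_distrib] using this
  have hsq' : ∑ x, ∑ j : Fin d, ∑ η, p η * (F η - F (exchange x (x + Pi.single j 1) η)) ^ 2
      ≤ 2 * (∑ η, p η * energy l (centered ρ η) + d * (n : ℝ) ^ d * κ ^ 2) := by
    calc ∑ x, ∑ j : Fin d, ∑ η, p η * (F η - F (exchange x (x + Pi.single j 1) η)) ^ 2
        = ∑ η, p η * ∑ x, ∑ j : Fin d, (F η - F (exchange x (x + Pi.single j 1) η)) ^ 2 := by
          simp only [Finset.mul_sum]
          rw [Finset.sum_comm]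
          rw [Finset.sum_comm (s := (Finset.univ : Finset (Config d n)))]
          rw [Finset.sum_comm]
          exact Finset.sum_congr rfl fun x _ => Finset.sum_comm
      _ ≤ ∑ η, p η * (2 * energy l (centered ρ η) + 2 * (d * (n : ℝ) ^ d * κ ^ 2)) :=
          Finset.sum_le_sum fun η _ => mul_le_mul_of_nonneg_left (hsq η) (hp η)
      _ = _ := by
          simp only [mul_add, Finset.sum_add_distrib, ← Finset.sum_mul, hp1]
          rw [Finset.mul_sum]
          congr 1
          · exact Finset.sum_congr rfl fun η _ => by ring
          · ring
  have h2 := mul_le_mul_of_nonneg_left hsq' (show 0 ≤ 1 / (2 * A) by positivity)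
  have h3 : 1 / (2 * A) * (2 * (∑ η, p η * energy l (centered ρ η) + d * (n : ℝ) ^ d * κ ^ 2))
      = 1 / A * (∑ η, p η * energy l (centered ρ η) + d * (n : ℝ) ^ d * κ ^ 2) := by
    field_simp
  rw [h3] at h2
  linarith

end Exchange

/-! ### Entropy production of the two dynamics -/

section Production

variable {d n : ℕ} [NeZero n]

/-- The flip of one opinion, as a permutation of the configurations. -/
def flipEquiv (x : Torus d n) : Config d n ≃ Config d n where
  toFun := flip x
  invFun := flip x
  left_inv η := by simp [flip]
  right_inv η := by simp [flip]

lemma bern_flip (ρ : ℝ) (x : Torus d n) (η : Config d n) :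
    bern d n ρ (flip x η) * (if η x then ρ else 1 - ρ)
      = bern d n ρ η * (if η x then 1 - ρ else ρ) := by
  have h : ∀ ζ : Config d n, bern d n ρ ζ = (if ζ x then ρ else 1 - ρ)
      * ∏ y ∈ Finset.univ.erase x, if ζ y then ρ else 1 - ρ := fun ζ => by
    rw [bern, Finset.mul_prod_erase _ (fun y => if ζ y then ρ else 1 - ρ) (Finset.mem_univ x)]
  have h2 : ∏ y ∈ Finset.univ.erase x, (if flip x η y then ρ else 1 - ρ)
      = ∏ y ∈ Finset.univ.erase x, if η y then ρ else 1 - ρ :=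
    Finset.prod_congr rfl fun y hy => by
      rw [flip, Function.update_of_ne (Finset.ne_of_mem_erase hy)]
  rw [h, h η, h2]
  cases hx : η x <;> simp [flip, hx] <;> ring

/-- The adjoint of one voter flip with respect to the Bernoulli measure, applied to the constant
function `1`, is the product of the two centred opinions, divided by `ρ (1 - ρ)`. -/
lemma sum_voter_flip {ρ : ℝ} (h0 : 0 < ρ) (h1 : ρ < 1) {x y : Torus d n} (hxy : y ≠ x)
    (f : Config d n → ℝ) :
    ∑ η, bern d n ρ η * ((occ (η y) - occ (η x)) ^ 2 * (f (flip x η) - f η))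
      = ∑ η, bern d n ρ η * f η * (centered ρ η x * centered ρ η y) / (ρ * (1 - ρ)) := by
  have h1' : 1 - ρ ≠ 0 := by linarith
  have e1 : ∑ η, bern d n ρ η * ((occ (η y) - occ (η x)) ^ 2 * f (flip x η))
      = ∑ η, bern d n ρ (flip x η) * ((occ (flip x η y) - occ (flip x η x)) ^ 2 * f η) := by
    have h := Equiv.sum_comp (flipEquiv x) fun η =>
      bern d n ρ η * ((occ (η y) - occ (η x)) ^ 2 * f (flip x η))
    rw [← h]
    refine Finset.sum_congr rfl fun η _ => ?_
    simp [flipEquiv, flip]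
  simp only [mul_sub, Finset.sum_sub_distrib, e1]
  rw [← Finset.sum_sub_distrib]
  refine Finset.sum_congr rfl fun η _ => ?_
  have h2 : flip x η y = η y := Function.update_of_ne hxy _ _
  have h3 : flip x η x = !η x := Function.update_self _ _ _
  have h4 := bern_flip ρ x η
  rw [h2, h3]
  cases hx : η x <;> cases hy : η y <;> simp only [hx, occ, centered, hy] at h4 ⊢ <;>
    simp at h4 ⊢ <;> field_simp <;> linear_combination f η * h4

lemma intCast_ne_zero {n : ℕ} {z : ℤ} (hz : z ≠ 0) (hn : z.natAbs < n) : (z : ZMod n) ≠ 0 := by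
  intro h
  rw [ZMod.intCast_zmod_eq_zero_iff_dvd] at h
  exact hz (Int.eq_zero_of_dvd_of_natAbs_lt_natAbs h (by simpa using hn))

lemma sum_neighbors (hn : 3 ≤ n) (x : Torus d n) (f : Torus d n → ℝ) :
    ∑ y ∈ neighbors x, f y = ∑ j, (f (x + Pi.single j 1) + f (x - Pi.single j 1)) := by
  have h1 : (1 : ZMod n) ≠ 0 := by
    have := intCast_ne_zero (n := n) (z := 1) one_ne_zero (by simp; omega)
    simpa using this
  have h2 : (1 : ZMod n) + 1 ≠ 0 := by
    have := intCast_ne_zero (n := n) (z := 2) two_ne_zero (by simp; omega)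
    intro h
    apply this
    push_cast
    rw [← h]
    norm_num
  have hinj : Function.Injective fun j : Fin d => (Pi.single j 1 : Torus d n) := fun i j h => by
    by_contra hij
    have := congrFun h i
    simp only [Pi.single_eq_same, Pi.single_eq_of_ne hij] at this
    exact h1 this
  have hset : neighbors x = Finset.univ.image (fun j : Fin d => x + Pi.single j 1)
      ∪ Finset.univ.image (fun j : Fin d => x - Pi.single j 1) := by
    ext y
    simp only [neighbors, Finset.mem_filter, Finset.mem_univ, true_and, Finset.mem_union,
      Finset.mem_image, exists_or, eq_comm (a := y)]
  rw [hset, Finset.sum_union, Finset.sum_image, Finset.sum_image, Finset.sum_add_distrib]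
  · exact fun i _ j _ h => hinj (sub_right_injective h)
  · exact fun i _ j _ h => hinj (add_right_injective x h)
  · rw [Finset.disjoint_left]
    intro y hy hy'
    simp only [Finset.mem_image, Finset.mem_univ, true_and] at hy hy'
    obtain ⟨i, rfl⟩ := hy
    obtain ⟨j, hj⟩ := hy'
    have h3 : (Pi.single i 1 : Torus d n) + Pi.single j 1 = 0 := by
      rw [sub_eq_add_neg] at hj
      rw [← add_left_cancel hj]
      simp
    have h4 := congrFun h3 i
    simp only [Pi.add_apply, Pi.single_eq_same, Pi.zero_apply] at h4
    rcases eq_or_ne i j with rfl | hij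
    · rw [Pi.single_eq_same] at h4
      exact h2 h4
    · rw [Pi.single_eq_of_ne hij, add_zero] at h4
      exact h1 h4

lemma sum_sum_neighbors (hn : 3 ≤ n) (ρ : ℝ) (η : Config d n) :
    ∑ x, ∑ y ∈ neighbors x, centered ρ η x * centered ρ η y = 2 * interaction ρ η := by
  simp only [sum_neighbors hn, Finset.sum_add_distrib]
  rw [two_mul]
  congr 1
  rw [interaction, Finset.sum_comm]
  refine Eq.trans ?_ Finset.sum_comm
  refine Finset.sum_congr rfl fun j _ => ?_
  have h := Equiv.sum_comp (Equiv.addRight (Pi.single j (1 : ZMod n)))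
    fun x : Torus d n => centered ρ η x * centered ρ η (x - Pi.single j 1)
  rw [← h]
  refine Finset.sum_congr rfl fun x _ => ?_
  simp only [Equiv.coe_addRight, add_sub_cancel_right]
  ring

/-- The entropy production of the voter dynamics is at most the mean of the adjoint generator
applied to `1`, which is a multiple of the interaction. -/
lemma production_voterGen_le (hn : 3 ≤ n) {ρ : ℝ} (h0 : 0 < ρ) (h1 : ρ < 1)
    {p : Config d n → ℝ} (hp : ∀ η, 0 ≤ p η) :
    production (voterGen d n) (bern d n ρ) p
      ≤ 2 / (ρ * (1 - ρ)) * ∑ η, p η * interaction ρ η := by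
  set f : Config d n → ℝ := fun η => p η / bern d n ρ η with hf
  have hf0 : ∀ η, 0 ≤ f η := fun η => div_nonneg (hp η) (bern_pos h0 h1 η).le
  have hstep : production (voterGen d n) (bern d n ρ) p
      ≤ ∑ η, bern d n ρ η * voterGen d n f η := by
    rw [production, Finset.mul_sum]
    refine Finset.sum_le_sum fun η _ => ?_
    have e : 2 * (bern d n ρ η * (√(f η) * voterGen d n (fun ξ => √(f ξ)) η))
        = bern d n ρ η * (2 * (√(f η) * voterGen d n (fun ξ => √(f ξ)) η)) := by ring
    refine (le_of_eq e).trans (mul_le_mul_of_nonneg_left ?_ (bern_pos h0 h1 η).le)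
    simp only [voterGen, LinearMap.coe_mk, AddHom.coe_mk, Finset.mul_sum]
    refine Finset.sum_le_sum fun x _ => Finset.sum_le_sum fun y _ => ?_
    have h2 := Real.sq_sqrt (hf0 (flip x η))
    have h3 := Real.sq_sqrt (hf0 η)
    have h4 : 2 * (√(f η) * (√(f (flip x η)) - √(f η))) ≤ f (flip x η) - f η := by
      nlinarith [sq_nonneg (√(f (flip x η)) - √(f η))]
    have h5 := mul_le_mul_of_nonneg_left h4 (sq_nonneg (occ (η y) - occ (η x)))
    linarith
  refine hstep.trans (le_of_eq ?_)
  have hne : ∀ x : Torus d n, ∀ y ∈ neighbors x, y ≠ x := fun x y hy h => by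
    have h2 : (1 : ZMod n) ≠ 0 := by
      have := intCast_ne_zero (n := n) (z := 1) one_ne_zero (by simp; omega)
      simpa using this
    simp only [neighbors, Finset.mem_filter, Finset.mem_univ, true_and] at hy
    obtain ⟨j, hj | hj⟩ := hy <;> rw [h] at hj
    · have h3 : (Pi.single j 1 : Torus d n) = 0 := by simpa using hj
      exact h2 (by simpa using congrFun h3 j)
    · have h3 : (Pi.single j 1 : Torus d n) = 0 := sub_eq_self.1 hj.symm
      exact h2 (by simpa using congrFun h3 j)
  have hfν : ∀ η, bern d n ρ η * f η = p η := fun η => mul_div_cancel₀ _ (bern_pos h0 h1 η).ne'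
  calc ∑ η, bern d n ρ η * voterGen d n f η
      = ∑ x, ∑ y ∈ neighbors x,
        ∑ η, bern d n ρ η * ((occ (η y) - occ (η x)) ^ 2 * (f (flip x η) - f η)) := by
        simp only [voterGen, LinearMap.coe_mk, AddHom.coe_mk, Finset.mul_sum]
        rw [Finset.sum_comm]
        exact Finset.sum_congr rfl fun x _ => Finset.sum_comm
    _ = ∑ x, ∑ y ∈ neighbors x,
        ∑ η, p η * (centered ρ η x * centered ρ η y) / (ρ * (1 - ρ)) := by
        refine Finset.sum_congr rfl fun x _ => Finset.sum_congr rfl fun y hy => ?_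
        rw [sum_voter_flip h0 h1 (hne x y hy)]
        simp only [hfν]
    _ = ∑ η, p η * (∑ x, ∑ y ∈ neighbors x, centered ρ η x * centered ρ η y) / (ρ * (1 - ρ)) := by
        simp only [Finset.mul_sum, Finset.sum_div]
        symm
        rw [Finset.sum_comm]
        exact Finset.sum_congr rfl fun x _ => Finset.sum_comm
    _ = 2 / (ρ * (1 - ρ)) * ∑ η, p η * interaction ρ η := by
        simp only [sum_sum_neighbors hn]
        rw [Finset.mul_sum]
        exact Finset.sum_congr rfl fun η _ => by ring

lemma dependsOn_inter {ι α β : Type*} {f : (ι → α) → β} {s t : Set ι} (hs : DependsOn f s)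
    (ht : DependsOn f t) : DependsOn f (s ∩ t) := by
  classical
  intro x y hxy
  have h1 : f x = f (s.piecewise x y) := hs fun i hi => by simp [hi]
  refine h1.trans (ht fun i hi => ?_)
  by_cases his : i ∈ s
  · simpa [his] using hxy i ⟨his, hi⟩
  · simp [his]

/-- If the torus is large, then the rate of an exchange does not depend on the opinions that are
exchanged. -/
lemma exists_forall_rate_exchange {c₀ : ℝ} {c : Fin d → LatticeConfig d → ℝ}
    (hc : IsGradientRates c₀ c) : ∃ n₀ : ℕ, ∀ (n : ℕ) [NeZero n], n₀ ≤ n →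
      ∀ (j : Fin d) (x : Torus d n) (η : Config d n),
        c j (torusShift x (exchange x (x + Pi.single j 1) η)) = c j (torusShift x η) := by
  choose A hA using hc.cylinder
  have hbound : ∃ M : ℕ, ∀ j, ∀ z ∈ A j, ∀ i, (z i).natAbs + 1 < M := by
    refine ⟨∑ j, ∑ z ∈ A j, ∑ i, (z i).natAbs + 2, fun j z hz i => ?_⟩
    have h1 := Finset.single_le_sum (f := fun i => (z i).natAbs) (fun _ _ => Nat.zero_le _)
      (Finset.mem_univ i)
    have h2 := Finset.single_le_sum (f := fun z : Fin d → ℤ => ∑ i, (z i).natAbs)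
      (fun _ _ => Nat.zero_le _) hz
    have h3 := Finset.single_le_sum (f := fun j => ∑ z ∈ A j, ∑ i, (z i).natAbs)
      (fun _ _ => Nat.zero_le _) (Finset.mem_univ j)
    omega
  obtain ⟨M, hM⟩ := hbound
  refine ⟨M, fun n _ hn j x η => ?_⟩
  refine dependsOn_inter (hA j) (hc.indep j) fun z hz => ?_
  obtain ⟨hzA, hz0⟩ := hz
  simp only [Set.mem_compl_iff, Set.mem_insert_iff, Set.mem_singleton_iff, not_or] at hz0
  have hlt := hM j z hzA
  simp only [torusShift, exchange]
  congr 1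
  refine Equiv.swap_apply_of_ne_of_ne (fun h => hz0.1 ?_) fun h => hz0.2 ?_
  · have h1 : (fun i => (z i : ZMod n)) = 0 := by simpa using h
    funext i
    by_contra hi
    exact intCast_ne_zero hi (by have := hlt i; omega) (congrFun h1 i)
  · have h1 : (fun i => (z i : ZMod n)) = Pi.single j 1 := by simpa using h
    funext i
    by_contra hi
    refine intCast_ne_zero (n := n) (sub_ne_zero.2 hi) ?_ ?_
    · have h2 := hlt i
      have h3 : ((Pi.single j 1 : Fin d → ℤ) i).natAbs ≤ 1 := by
        rw [Pi.single_apply]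
        split_ifs <;> simp
      have h4 := Int.natAbs_sub_le (z i) ((Pi.single j 1 : Fin d → ℤ) i)
      omega
    · have h2 := congrFun h1 i
      rw [Int.cast_sub, h2, sub_eq_zero]
      rcases eq_or_ne i j with rfl | hij
      · simp
      · simp [Pi.single_eq_of_ne hij]

/-- The exclusion dynamics is reversible, so that its entropy production is minus a Dirichlet
form. -/
lemma production_exclusionGen_le {c₀ ρ : ℝ} (h0 : 0 < ρ) (h1 : ρ < 1)
    {c : Fin d → LatticeConfig d → ℝ} (hlow : ∀ j η, c₀ ≤ c j η)
    (hc : ∀ (j : Fin d) (x : Torus d n) (η : Config d n),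
      c j (torusShift x (exchange x (x + Pi.single j 1) η)) = c j (torusShift x η))
    (p : Config d n → ℝ) :
    production (exclusionGen d n c) (bern d n ρ) p
      ≤ -(c₀ * dirichlet ρ fun η => √(p η / bern d n ρ η)) := by
  set g : Config d n → ℝ := fun η => √(p η / bern d n ρ η) with hg
  have e1 : production (exclusionGen d n c) (bern d n ρ) p
      = ∑ x, ∑ j : Fin d, 2 * ∑ η, bern d n ρ η * (g η * (c j (torusShift x η)
        * (g (exchange x (x + Pi.single j 1) η) - g η))) := by
    rw [production, Finset.mul_sum]
    simp only [exclusionGen, LinearMap.coe_mk, AddHom.coe_mk, Finset.mul_sum]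
    rw [Finset.sum_comm]
    exact Finset.sum_congr rfl fun x _ => Finset.sum_comm
  rw [e1, dirichlet, Finset.mul_sum, ← Finset.sum_neg_distrib]
  refine Finset.sum_le_sum fun x _ => ?_
  rw [Finset.mul_sum, ← Finset.sum_neg_distrib]
  refine Finset.sum_le_sum fun j _ => ?_
  set σ := exchange x (x + Pi.single j (1 : ZMod n)) with hσ
  have e2 : ∑ η, bern d n ρ η * (g η * (c j (torusShift x η) * (g (σ η) - g η)))
      = ∑ η, bern d n ρ η * (g (σ η) * (c j (torusShift x η) * (g η - g (σ η)))) := by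
    rw [← sum_comp_exchange x (x + Pi.single j 1)]
    refine Finset.sum_congr rfl fun η _ => ?_
    rw [bern_exchange, hc, hσ, exchange_exchange]
  rw [two_mul]
  nth_rewrite 2 [e2]
  rw [← Finset.sum_add_distrib, Finset.mul_sum, ← Finset.sum_neg_distrib]
  refine Finset.sum_le_sum fun η _ => ?_
  have h2 : 0 ≤ bern d n ρ η * (g (σ η) - g η) ^ 2 :=
    mul_nonneg (bern_pos h0 h1 η).le (sq_nonneg _)
  have h3 := mul_le_mul_of_nonneg_right (hlow j (torusShift x η)) h2
  linarith

lemma production_generator (c : Fin d → LatticeConfig d → ℝ) (a : ℝ) (ν p : Config d n → ℝ) :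
    production (generator d n c a) ν p
      = (n : ℝ) ^ 2 * production (exclusionGen d n c) ν p + a * production (voterGen d n) ν p := by
  simp only [production, generator, LinearMap.add_apply, LinearMap.smul_apply, Pi.add_apply,
    Pi.smul_apply, smul_eq_mul, mul_add, Finset.sum_add_distrib, Finset.mul_sum]
  congr 1 <;> exact Finset.sum_congr rfl fun η _ => by ring

end Production

/-! ### Bounds for the Green function at the origin -/

section GreenBounds

variable {d n : ℕ} [NeZero n]

/-- The return probability at time `t` of the continuous-time random walk on `ℤ/nℤ` with jump
rate `1` to each neighbour. -/
def heat (n : ℕ) [NeZero n] (t : ℝ) : ℝ :=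
  (∑ k : ZMod n, Real.exp (-(t * (2 - 2 * cosMod k)))) / n

lemma heat_nonneg (t : ℝ) : 0 ≤ heat n t :=
  div_nonneg (Finset.sum_nonneg fun _ _ => (Real.exp_pos _).le) (Nat.cast_nonneg _)

lemma natCast_pos' : 0 < (n : ℝ) := Nat.cast_pos.2 (NeZero.pos n)

lemma heat_le_one {t : ℝ} (ht : 0 ≤ t) : heat n t ≤ 1 := by
  rw [heat, div_le_one natCast_pos']
  calc ∑ k : ZMod n, Real.exp (-(t * (2 - 2 * cosMod k))) ≤ ∑ _k : ZMod n, (1 : ℝ) :=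
        Finset.sum_le_sum fun k _ => Real.exp_le_one_iff.2 (by
          have := mul_nonneg ht (show 0 ≤ 2 - 2 * cosMod k by linarith [cosMod_le_one k])
          linarith)
    _ = n := by simp [ZMod.card]

lemma sum_zmod_eq_sum_range (f : ZMod n → ℝ) : ∑ k, f k = ∑ i ∈ Finset.range n, f i := by
  obtain ⟨m, rfl⟩ := Nat.exists_eq_succ_of_ne_zero (NeZero.ne n)
  rw [Finset.sum_range]
  refine Finset.sum_congr rfl fun k _ => ?_
  exact congrArg f (Fin.cast_val_eq_self k).symm

lemma sum_exp_neg_mul_sq_le {c : ℝ} (hc : 0 < c) (m : ℕ) :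
    ∑ i ∈ Finset.range m, Real.exp (-c * ((i + 1 : ℕ) : ℝ) ^ 2) ≤ √(Real.pi / c) / 2 := by
  have hanti : AntitoneOn (fun x : ℝ => Real.exp (-c * x ^ 2)) (Set.Icc 0 (0 + m)) :=
    fun x hx y _ hxy => Real.exp_le_exp.2 (by
      have := pow_le_pow_left₀ hx.1 hxy 2
      nlinarith)
  have h1 := hanti.sum_le_integral
  simp only [zero_add] at h1
  refine h1.trans ?_
  rw [← integral_gaussian_Ioi c, intervalIntegral.integral_of_le (Nat.cast_nonneg m)]
  exact setIntegral_mono_set (integrable_exp_neg_mul_sq hc).integrableOn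
    (ae_of_all _ fun x => (Real.exp_pos _).le)
    (Set.Ioc_subset_Ioi_self).eventuallyLE

lemma exp_neg_cosMod_le {t : ℝ} (ht : 0 ≤ t) {i : ℕ} (hi : i ≤ n) :
    Real.exp (-(t * (2 - 2 * cosMod (i : ZMod n))))
      ≤ Real.exp (-(16 * t / (n : ℝ) ^ 2) * (i : ℝ) ^ 2)
        + Real.exp (-(16 * t / (n : ℝ) ^ 2) * ((n - i : ℕ) : ℝ) ^ 2) := by
  have hn : 0 < (n : ℝ) := natCast_pos'
  have key : ∀ j : ℤ, |(j : ℝ)| ≤ n / 2 → cosMod (j : ZMod n) = cosMod (i : ZMod n) →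
      Real.exp (-(t * (2 - 2 * cosMod (i : ZMod n))))
        ≤ Real.exp (-(16 * t / (n : ℝ) ^ 2) * (j : ℝ) ^ 2) := fun j hj hji => by
    rw [← hji, cosMod_intCast]
    refine Real.exp_le_exp.2 ?_
    have h1 : |2 * Real.pi * j / n| ≤ Real.pi := by
      rw [abs_div, abs_mul, abs_of_pos Real.two_pi_pos, abs_of_pos hn, div_le_iff₀ hn]
      nlinarith [Real.pi_pos]
    have h2 := Real.cos_le_one_sub_mul_cos_sq h1
    have h3 : 2 / Real.pi ^ 2 * (2 * Real.pi * j / n) ^ 2 = 8 * (j : ℝ) ^ 2 / (n : ℝ) ^ 2 := by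
      have := Real.pi_pos
      field_simp
      ring
    rw [h3] at h2
    have h4 := mul_le_mul_of_nonneg_left h2 ht
    have h5 : -(16 * t / (n : ℝ) ^ 2) * (j : ℝ) ^ 2
        = -(2 * t * (8 * (j : ℝ) ^ 2 / (n : ℝ) ^ 2)) := by ring
    rw [h5]
    linarith
  rcases le_total (2 * i) n with h | h
  · have h1 : (2 * i : ℝ) ≤ n := by exact_mod_cast h
    have h2 := key i (by
      rw [Int.cast_natCast, abs_of_nonneg (Nat.cast_nonneg i)]; linarith) (by simp)
    rw [Int.cast_natCast] at h2
    exact h2.trans (le_add_of_nonneg_right (Real.exp_pos _).le)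
  · have h1 : (n : ℝ) ≤ 2 * i := by exact_mod_cast h
    have h3 : (i : ℝ) ≤ n := by exact_mod_cast hi
    have h2 := key ((n - i : ℕ) : ℤ) (by
      rw [Int.cast_natCast, abs_of_nonneg (Nat.cast_nonneg _), Nat.cast_sub hi]; linarith) (by
      rw [Int.cast_natCast, Nat.cast_sub hi, ZMod.natCast_self, zero_sub, cosMod_neg])
    rw [Int.cast_natCast] at h2
    exact h2.trans (le_add_of_nonneg_left (Real.exp_pos _).le)

lemma heat_le {t : ℝ} (ht : 0 < t) : heat n t ≤ 1 / n + 1 / (2 * √t) := by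
  have hn : 0 < (n : ℝ) := natCast_pos'
  set c : ℝ := 16 * t / (n : ℝ) ^ 2 with hc
  have hc0 : 0 < c := by positivity
  have hsum : ∑ k : ZMod n, Real.exp (-(t * (2 - 2 * cosMod k))) ≤ 1 + √(Real.pi / c) := by
    rw [sum_zmod_eq_sum_range]
    obtain ⟨m, hm⟩ := Nat.exists_eq_succ_of_ne_zero (NeZero.ne n)
    have hr : Finset.range n = Finset.range (m + 1) := by rw [hm]
    rw [hr, Finset.sum_range_succ']
    have h0 : Real.exp (-(t * (2 - 2 * cosMod ((0 : ℕ) : ZMod n)))) = 1 := by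
      simp [cosMod_zero]
    rw [h0]
    have h1 : ∑ i ∈ Finset.range m, Real.exp (-(t * (2 - 2 * cosMod ((i + 1 : ℕ) : ZMod n))))
        ≤ ∑ i ∈ Finset.range m, Real.exp (-c * ((i + 1 : ℕ) : ℝ) ^ 2)
          + ∑ i ∈ Finset.range m, Real.exp (-c * ((m - 1 - i + 1 : ℕ) : ℝ) ^ 2) := by
      rw [← Finset.sum_add_distrib]
      refine Finset.sum_le_sum fun i hi => ?_
      have hi' := Finset.mem_range.1 hi
      have h2 := exp_neg_cosMod_le (n := n) ht.le (i := i + 1) (by omega)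
      rwa [show n - (i + 1) = m - 1 - i + 1 by omega] at h2
    rw [Finset.sum_range_reflect (fun i => Real.exp (-c * ((i + 1 : ℕ) : ℝ) ^ 2))] at h1
    have h2 := sum_exp_neg_mul_sq_le hc0 m
    linarith
  have hsq : √(Real.pi / c) ≤ n / (2 * √t) := by
    refine Real.sqrt_le_iff.2 ⟨by positivity, ?_⟩
    rw [div_pow, mul_pow, Real.sq_sqrt ht.le, hc, div_div_eq_mul_div,
      div_le_div_iff₀ (by positivity) (by positivity)]
    have h3 := mul_le_mul_of_nonneg_right Real.pi_le_four
      (show 0 ≤ (n : ℝ) ^ 2 * (2 ^ 2 * t) by positivity)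
    nlinarith
  rw [heat, div_le_iff₀ hn]
  have h4 : (1 / n + 1 / (2 * √t)) * n = 1 + n / (2 * √t) := by
    field_simp
  rw [h4]
  linarith

lemma integrableOn_exp_neg_mul {c : ℝ} (hc : 0 < c) :
    IntegrableOn (fun t : ℝ => Real.exp (-(c * t))) (Set.Ioi 0) := by
  simpa only [neg_mul] using exp_neg_integrableOn_Ioi 0 hc

lemma integral_exp_neg_mul {c : ℝ} (hc : 0 < c) :
    ∫ t in Set.Ioi (0 : ℝ), Real.exp (-(c * t)) = 1 / c := by
  have h := Real.integral_rpow_mul_exp_neg_mul_Ioi one_pos hc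
  simpa using h

lemma exp_mul_heat_pow (d : ℕ) (l t : ℝ) : Real.exp (-(l * t)) * heat n t ^ d
    = (∑ k : Torus d n, Real.exp (-((l + eig k) * t))) / (n : ℝ) ^ d := by
  have h := Fintype.sum_pow (fun k : ZMod n => Real.exp (-(t * (2 - 2 * cosMod k)))) d
  rw [heat, div_pow, h, ← mul_div_assoc, Finset.mul_sum]
  congr 1
  refine Finset.sum_congr rfl fun k _ => ?_
  rw [← Real.exp_sum, ← Real.exp_add, Finset.sum_neg_distrib, ← Finset.mul_sum]
  congr 1
  rw [eig]
  ring

/-- The Green function at the origin is the Laplace transform of the return probability, which is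
a product over the coordinates. -/
lemma greenZero_eq_integral (d : ℕ) {l : ℝ} (hl : 0 < l) :
    IntegrableOn (fun t => Real.exp (-(l * t)) * heat n t ^ d) (Set.Ioi 0) ∧
    greenZero d n l = ∫ t in Set.Ioi (0 : ℝ), Real.exp (-(l * t)) * heat n t ^ d := by
  simp only [exp_mul_heat_pow]
  have hi : ∀ k : Torus d n, IntegrableOn (fun t : ℝ => Real.exp (-((l + eig k) * t)))
      (Set.Ioi 0) := fun k => integrableOn_exp_neg_mul (add_eig_pos hl k)
  refine ⟨(integrable_finsetSum _ fun k _ => hi k).div_const _, ?_⟩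
  rw [integral_div, integral_finsetSum _ fun k _ => hi k, greenZero]
  simp only [integral_exp_neg_mul (add_eig_pos hl _)]

lemma integral_rpow_mul_exp_neg {α l : ℝ} (hα : 0 < α) (hl : 0 < l) :
    IntegrableOn (fun t : ℝ => t ^ (α - 1) * Real.exp (-(l * t))) (Set.Ioi 0) ∧
    ∫ t in Set.Ioi (0 : ℝ), t ^ (α - 1) * Real.exp (-(l * t))
      = (1 / l) ^ α * Real.Gamma α := by
  have h := Real.integral_rpow_mul_exp_neg_mul_Ioi hα hl
  refine ⟨?_, h⟩
  refine Integrable.of_integral_ne_zero ?_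
  rw [h]
  have := Real.Gamma_pos_of_pos hα
  positivity

/-- A bound of the return probability by `r + t^(α-1)` gives a bound of the Green function. -/
lemma greenZero_le_of_heat_pow_le {l α r : ℝ} (hl : 0 < l) (hα : 0 < α)
    (h : ∀ t, 0 < t → heat n t ^ d ≤ r + t ^ (α - 1)) :
    greenZero d n l ≤ r / l + (1 / l) ^ α * Real.Gamma α := by
  obtain ⟨h1, h2⟩ := greenZero_eq_integral (n := n) d hl
  obtain ⟨h3, h4⟩ := integral_rpow_mul_exp_neg hα hl
  rw [h2]
  calc ∫ t in Set.Ioi (0 : ℝ), Real.exp (-(l * t)) * heat n t ^ d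
      ≤ ∫ t in Set.Ioi (0 : ℝ), (r * Real.exp (-(l * t)) + t ^ (α - 1) * Real.exp (-(l * t))) := by
        refine setIntegral_mono_on h1 (((integrableOn_exp_neg_mul hl).const_mul r).add h3)
          measurableSet_Ioi fun t ht => ?_
        have := mul_le_mul_of_nonneg_left (h t ht) (Real.exp_pos (-(l * t))).le
        linarith
    _ = r / l + (1 / l) ^ α * Real.Gamma α := by
        rw [integral_add ((integrableOn_exp_neg_mul hl).const_mul r) h3, h4, integral_const_mul,
          integral_exp_neg_mul hl]
        ring

lemma greenZero_le_one_dim (hd : 1 ≤ d) {l : ℝ} (hl : 0 < l) :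
    greenZero d n l ≤ 1 / n / l + 2 * √(1 / l) := by
  have h := greenZero_le_of_heat_pow_le (d := d) (n := n) (r := 1 / n) hl one_half_pos
    fun t ht => by
      have h1 : heat n t ^ d ≤ heat n t := by
        simpa using pow_le_pow_of_le_one (heat_nonneg t) (heat_le_one ht.le) hd
      refine h1.trans ((heat_le ht).trans ?_)
      have h2 : t ^ ((1 : ℝ) / 2 - 1) = 1 / √t := by
        rw [Real.sqrt_eq_rpow, one_div (t ^ _), ← Real.rpow_neg ht.le]
        norm_num
      rw [h2]
      have h3 := Real.sqrt_pos.2 ht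
      have h4 : 1 / (2 * √t) ≤ 1 / √t := one_div_le_one_div_of_le h3 (by linarith)
      linarith
  have h5 : Real.Gamma (1 / 2) ≤ 2 := by
    rw [Real.Gamma_one_half_eq]
    exact Real.sqrt_le_iff.2 ⟨by norm_num, by linarith [Real.pi_le_four]⟩
  rw [← Real.sqrt_eq_rpow] at h
  have := mul_le_mul_of_nonneg_left h5 (Real.sqrt_nonneg (1 / l))
  linarith

lemma Gamma_le_inv {α : ℝ} (h0 : 0 < α) (h1 : α ≤ 1) : Real.Gamma α ≤ 1 / α := by
  have h2 := Real.convexOn_Gamma.2 (show (1 : ℝ) ∈ Set.Ioi 0 by simp)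
    (show (2 : ℝ) ∈ Set.Ioi 0 by simp) (show 0 ≤ 1 - α by linarith) h0.le (by ring)
  simp only [smul_eq_mul, Real.Gamma_one, Real.Gamma_two] at h2
  have h3 : (1 - α) * 1 + α * 2 = α + 1 := by ring
  rw [h3, Real.Gamma_add_one h0.ne'] at h2
  rw [le_div_iff₀ h0]
  linarith

/-- In two dimensions the logarithm comes from the exponent `α = 1 / log n`. -/
lemma greenZero_le_two_dim (hn : 3 ≤ n) {l : ℝ} (hl : 0 < l) (hln : 1 / (n : ℝ) ^ 2 ≤ l) :
    greenZero 2 n l ≤ 2 / (n : ℝ) ^ 2 / l + 8 * Real.log n := by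
  have hn0 : 0 < (n : ℝ) := natCast_pos'
  have hn3 : (3 : ℝ) ≤ n := by exact_mod_cast hn
  have hlog : 1 ≤ Real.log n := by
    rw [Real.le_log_iff_exp_le hn0]
    linarith [Real.exp_one_lt_d9]
  set α : ℝ := 1 / Real.log n with hα
  have hα0 : 0 < α := by positivity
  have hα1 : α ≤ 1 := by
    rw [hα, div_le_one (by linarith)]
    exact hlog
  have h := greenZero_le_of_heat_pow_le (d := 2) (n := n) (r := 2 / (n : ℝ) ^ 2) hl hα0
    fun t ht => by
      have hr : 0 ≤ 2 / (n : ℝ) ^ 2 := by positivity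
      rcases le_total t 1 with h1 | h1
      · have h2 : 1 ≤ t ^ (α - 1) :=
          Real.one_le_rpow_of_pos_of_le_one_of_nonpos ht h1 (by linarith)
        have h3 := pow_le_one₀ (n := 2) (heat_nonneg (n := n) t) (heat_le_one ht.le)
        linarith
      · have h2 : heat n t ^ 2 ≤ (1 / n + 1 / (2 * √t)) ^ 2 :=
          pow_le_pow_left₀ (heat_nonneg t) (heat_le ht) 2
        have h3 : (1 / (n : ℝ) + 1 / (2 * √t)) ^ 2
            ≤ 2 * (1 / (n : ℝ)) ^ 2 + 2 * (1 / (2 * √t)) ^ 2 := by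
          nlinarith [sq_nonneg (1 / (n : ℝ) - 1 / (2 * √t))]
        have h4 : (1 / (2 * √t)) ^ 2 = 1 / (4 * t) := by
          rw [div_pow, mul_pow, Real.sq_sqrt ht.le]
          norm_num
        have h5 : (1 : ℝ) / t ≤ t ^ (α - 1) := by
          have h6 : (1 : ℝ) / t = t ^ (-1 : ℝ) := by rw [Real.rpow_neg_one, one_div]
          rw [h6]
          exact Real.rpow_le_rpow_of_exponent_le h1 (by linarith)
        have h7 : 2 * (1 / (4 * t)) ≤ 1 / t := by
          rw [← mul_div_assoc, div_le_div_iff₀ (by positivity) ht]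
          linarith
        have h8 : 2 * (1 / (n : ℝ)) ^ 2 = 2 / (n : ℝ) ^ 2 := by ring
        rw [h4, h8] at h3
        linarith
  have h1 : (1 / l) ^ α ≤ 8 := by
    have h2 : 1 / l ≤ (n : ℝ) ^ 2 := by
      rw [div_le_iff₀ hl]
      rw [div_le_iff₀ (by positivity)] at hln
      linarith
    calc (1 / l) ^ α ≤ ((n : ℝ) ^ 2) ^ α := Real.rpow_le_rpow (by positivity) h2 hα0.le
      _ = Real.exp 1 ^ 2 := by
          rw [Real.rpow_def_of_pos (by positivity), Real.log_pow, hα, ← Real.exp_nat_mul]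
          congr 1
          have : Real.log n ≠ 0 := by linarith
          push_cast
          field_simp
      _ ≤ 8 := by nlinarith [Real.exp_one_lt_d9, Real.exp_pos 1]
  have h2 := Gamma_le_inv hα0 hα1
  rw [show 1 / α = Real.log n by rw [hα, one_div_one_div]] at h2
  have h3 : (1 / l) ^ α * Real.Gamma α ≤ 8 * Real.log n :=
    mul_le_mul h1 h2 (Real.Gamma_pos_of_pos hα0).le (by norm_num)
  linarith

lemma greenZero_le_three_dim (hd : 3 ≤ d) {l : ℝ} (hl : 0 < l) :
    greenZero d n l ≤ 3 + 4 / (n : ℝ) ^ 3 / l := by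
  have hn0 : 0 < (n : ℝ) := natCast_pos'
  obtain ⟨h1, h2⟩ := greenZero_eq_integral (n := n) d hl
  have hexp : ∀ t : ℝ, 0 < t → Real.exp (-(l * t)) ≤ 1 := fun t ht =>
    Real.exp_le_one_iff.2 (by have := mul_pos hl ht; linarith)
  have hI := integrableOn_exp_neg_mul hl
  have hJ : IntegrableOn (fun t : ℝ => t ^ (-(3 / 2) : ℝ)) (Set.Ioi 1) :=
    integrableOn_Ioi_rpow_of_lt (by norm_num) one_pos
  have hsub : Set.Ioi (1 : ℝ) ⊆ Set.Ioi 0 := Set.Ioi_subset_Ioi zero_le_one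
  rw [h2, ← Set.Ioc_union_Ioi_eq_Ioi (zero_le_one (α := ℝ)),
    setIntegral_union Set.Ioc_disjoint_Ioi_same measurableSet_Ioi
      (h1.mono_set Set.Ioc_subset_Ioi_self) (h1.mono_set hsub)]
  have hA : ∫ t in Set.Ioc (0 : ℝ) 1, Real.exp (-(l * t)) * heat n t ^ d ≤ 1 := by
    calc ∫ t in Set.Ioc (0 : ℝ) 1, Real.exp (-(l * t)) * heat n t ^ d
        ≤ ∫ _t in Set.Ioc (0 : ℝ) 1, (1 : ℝ) := by
          refine setIntegral_mono_on (h1.mono_set Set.Ioc_subset_Ioi_self)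
            (integrableOn_const (by simp)) measurableSet_Ioc fun t ht => ?_
          exact mul_le_one₀ (hexp t ht.1) (pow_nonneg (heat_nonneg t) d)
            (pow_le_one₀ (heat_nonneg t) (heat_le_one ht.1.le))
      _ = 1 := by simp
  have hB : ∫ t in Set.Ioi (1 : ℝ), Real.exp (-(l * t)) * heat n t ^ d
      ≤ 4 / (n : ℝ) ^ 3 / l + 2 := by
    calc ∫ t in Set.Ioi (1 : ℝ), Real.exp (-(l * t)) * heat n t ^ d
        ≤ ∫ t in Set.Ioi (1 : ℝ),
            (4 / (n : ℝ) ^ 3 * Real.exp (-(l * t)) + t ^ (-(3 / 2) : ℝ)) := by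
          refine setIntegral_mono_on (h1.mono_set hsub)
            (((hI.mono_set hsub).const_mul _).add hJ) measurableSet_Ioi fun t ht => ?_
          have ht0 : 0 < t := hsub ht
          have hs := Real.sqrt_pos.2 ht0
          have e1 : heat n t ^ d ≤ heat n t ^ 3 :=
            pow_le_pow_of_le_one (heat_nonneg t) (heat_le_one ht0.le) hd
          have e2 : heat n t ^ 3 ≤ (1 / n + 1 / (2 * √t)) ^ 3 :=
            pow_le_pow_left₀ (heat_nonneg t) (heat_le ht0) 3
          have e3 : (1 / (n : ℝ) + 1 / (2 * √t)) ^ 3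
              ≤ 4 * (1 / (n : ℝ)) ^ 3 + 4 * (1 / (2 * √t)) ^ 3 := by
            have hx : 0 ≤ 1 / (n : ℝ) := by positivity
            have hy : 0 ≤ 1 / (2 * √t) := by positivity
            nlinarith [mul_nonneg (add_nonneg hx hy)
              (sq_nonneg (1 / (n : ℝ) - 1 / (2 * √t)))]
          have e4 : 4 * (1 / (2 * √t)) ^ 3 ≤ t ^ (-(3 / 2) : ℝ) := by
            have : t ^ (-(3 / 2) : ℝ) = (1 / √t) ^ 3 := by
              rw [Real.sqrt_eq_rpow, one_div (t ^ _), ← Real.rpow_neg ht0.le, ← Real.rpow_natCast,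
                ← Real.rpow_mul ht0.le]
              norm_num
            rw [this]
            have e5 : 4 * (1 / (2 * √t)) ^ 3 = 1 / 2 * (1 / √t) ^ 3 := by
              field_simp
              norm_num
            rw [e5]
            have : 0 < (1 / √t) ^ 3 := by positivity
            linarith
          have e6 : 4 * (1 / (n : ℝ)) ^ 3 = 4 / (n : ℝ) ^ 3 := by ring
          rw [e6] at e3
          have e7 : heat n t ^ d ≤ 4 / (n : ℝ) ^ 3 + t ^ (-(3 / 2) : ℝ) := by linarith
          have e8 := mul_le_mul_of_nonneg_left e7 (Real.exp_pos (-(l * t))).le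
          have e9 := mul_le_mul_of_nonneg_right (hexp t ht0)
            (Real.rpow_nonneg ht0.le (-(3 / 2) : ℝ))
          linarith
      _ = 4 / (n : ℝ) ^ 3 * (∫ t in Set.Ioi (1 : ℝ), Real.exp (-(l * t))) + 2 := by
          rw [integral_add ((hI.mono_set hsub).const_mul _) hJ, integral_const_mul,
            integral_Ioi_rpow_of_lt (by norm_num) one_pos]
          norm_num
      _ ≤ 4 / (n : ℝ) ^ 3 * (∫ t in Set.Ioi (0 : ℝ), Real.exp (-(l * t))) + 2 := by
          have := setIntegral_mono_set hI (ae_of_all _ fun t => (Real.exp_pos (-(l * t))).le)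
            hsub.eventuallyLE
          gcongr
      _ = 4 / (n : ℝ) ^ 3 / l + 2 := by
          rw [integral_exp_neg_mul hl]
          ring
  linarith

/-- The error term of the entropy bound dominates the rescaled Green function. -/
lemma mul_greenZero_le_errorTerm (hd : 1 ≤ d) (hn : 3 ≤ n) {a : ℝ} (ha : 1 ≤ a) :
    a / (n : ℝ) ^ 2 * (n : ℝ) ^ d * greenZero d n (a / (n : ℝ) ^ 2) ≤ 10 * errorTerm d n a := by
  have hn0 : 0 < (n : ℝ) := natCast_pos'
  have hn3 : (3 : ℝ) ≤ n := by exact_mod_cast hn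
  have ha0 : 0 < a := by linarith
  set l := a / (n : ℝ) ^ 2 with hl
  have hl0 : 0 < l := by positivity
  have hcases : d = 1 ∨ d = 2 ∨ 3 ≤ d := by omega
  rcases hcases with rfl | rfl | hd3
  · have h1 := mul_le_mul_of_nonneg_left (greenZero_le_one_dim (n := n) (d := 1) le_rfl hl0)
      (show 0 ≤ l * (n : ℝ) ^ 1 by positivity)
    have hsa : 1 ≤ √a := Real.one_le_sqrt.2 ha
    have h2 : √(1 / l) = n / √a := by
      rw [hl, one_div_div, Real.sqrt_div (by positivity), Real.sqrt_sq hn0.le]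
    have h3 : l * (n : ℝ) ^ 1 * (1 / n / l + 2 * √(1 / l)) = 1 + 2 * √a := by
      rw [h2]
      have h4 : l * (n : ℝ) ^ 1 * (2 * (n / √a)) = 2 * (a / √a) := by
        rw [hl]
        field_simp
      have h5 : l * (n : ℝ) ^ 1 * (1 / n / l) = 1 := by
        field_simp
      rw [mul_add, h4, h5, Real.div_sqrt]
    rw [h3] at h1
    simp only [errorTerm, if_true]
    linarith
  · have hln : 1 / (n : ℝ) ^ 2 ≤ l := by
      rw [hl]
      gcongr
    have h1 := mul_le_mul_of_nonneg_left (greenZero_le_two_dim hn hl0 hln)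
      (show 0 ≤ l * (n : ℝ) ^ 2 by positivity)
    have hlog : 1 ≤ Real.log n := by
      rw [Real.le_log_iff_exp_le hn0]
      linarith [Real.exp_one_lt_d9]
    have h3 : l * (n : ℝ) ^ 2 * (2 / (n : ℝ) ^ 2 / l + 8 * Real.log n)
        = 2 + 8 * (a * Real.log n) := by
      have h4 : l * (n : ℝ) ^ 2 = a := by
        rw [hl]
        field_simp
      rw [mul_add, h4, ← h4]
      field_simp
    rw [h3] at h1
    have h5 : 1 ≤ a * Real.log n := one_le_mul_of_one_le_of_one_le ha hlog
    simp only [errorTerm, OfNat.ofNat_ne_one, if_false, if_true]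
    linarith
  · have h1 := mul_le_mul_of_nonneg_left (greenZero_le_three_dim (n := n) hd3 hl0)
      (show 0 ≤ l * (n : ℝ) ^ d by positivity)
    have h2 : l * (n : ℝ) ^ d = a * (n : ℝ) ^ (d - 2) := by
      rw [hl, div_mul_eq_mul_div, div_eq_iff (by positivity), mul_assoc, ← pow_add]
      congr 2
      omega
    have h3 : 4 / (n : ℝ) ^ 3 / l ≤ 4 := by
      have h4 : 4 / (n : ℝ) ^ 3 / l = 4 / (n * a) := by
        rw [hl]
        field_simp
      rw [h4]
      refine div_le_self (by norm_num) ?_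
      exact one_le_mul_of_one_le_of_one_le (by linarith) ha
    have h5 : 0 ≤ a * (n : ℝ) ^ (d - 2) := by positivity
    rw [errorTerm, if_neg (by omega), if_neg (by omega), h2]
    rw [h2] at h1
    nlinarith

end GreenBounds

/-! ### The bound of the entropy production -/

section Final

variable {d n : ℕ} [NeZero n]

/-- The constant of the entropy bound on large tori. -/
def entropyConst (d : ℕ) (ρ c₀ : ℝ) : ℝ :=
  4 * d / (ρ * (1 - ρ)) * (20 * (1 + 2 * d / (ρ * (1 - ρ) * c₀))
    + 10 * (1 + 4 * d) / (4 * (ρ * (1 - ρ) * c₀)))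

lemma entropyConst_pos (hd : 1 ≤ d) {ρ c₀ : ℝ} (h0 : 0 < ρ) (h1 : ρ < 1) (hc₀ : 0 < c₀) :
    0 < entropyConst d ρ c₀ := by
  have hd0 : (0 : ℝ) < d := Nat.cast_pos.2 (by omega)
  have h1' : 0 < 1 - ρ := by linarith
  unfold entropyConst
  positivity

lemma one_le_mul_greenZero {l : ℝ} (hl : 0 < l) (hl1 : l ≤ 1) :
    1 ≤ (1 + 4 * d) * greenZero d n l := by
  have h1 : ∀ k : Torus d n, 1 / (1 + 4 * (d : ℝ)) ≤ 1 / (l + eig k) := fun k => by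
    refine one_div_le_one_div_of_le (add_eig_pos hl k) ?_
    have h2 : eig k ≤ ∑ _j : Fin d, (4 : ℝ) := by
      refine Finset.sum_le_sum fun j _ => ?_
      nlinarith [cosMod_sq_add_sinMod_sq (k j), sq_nonneg (sinMod (k j)),
        sq_nonneg (cosMod (k j) + 1)]
    simp only [Finset.sum_const, Finset.card_univ, Fintype.card_fin, nsmul_eq_mul] at h2
    linarith
  have h2 : (n : ℝ) ^ d * (1 / (1 + 4 * (d : ℝ))) ≤ ∑ k : Torus d n, 1 / (l + eig k) := by
    have h3 := Finset.sum_le_sum fun k (_ : k ∈ (Finset.univ : Finset (Torus d n))) => h1 k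
    simpa using h3
  have hd0 : (0 : ℝ) < 1 + 4 * d := by positivity
  have hv := volume_pos (d := d) (n := n)
  rw [greenZero, ← mul_div_assoc, le_div_iff₀ hv, one_mul]
  have h4 := mul_le_mul_of_nonneg_left h2 hd0.le
  have h5 : (1 + 4 * (d : ℝ)) * ((n : ℝ) ^ d * (1 / (1 + 4 * (d : ℝ)))) = (n : ℝ) ^ d := by
    field_simp
  linarith

/-- The choice `A = 2 κ χ c₀ / l` makes the Dirichlet form in `interaction_le` match the one in
the entropy production. -/
lemma interaction_le_of_bounds {δ χ κ l c₀ H R E N D I : ℝ} (hδ : 0 < δ) (hχ : 0 < χ)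
    (hκ : 0 < κ) (hl : 0 < l) (hc₀ : 0 < c₀) (hE : 0 ≤ E) (hH : 0 ≤ H) (hR : 0 ≤ R)
    (hκδ : 1 ≤ 4 * δ * κ) (hlE : l * E ≤ 4 * H + 20 * R)
    (hlN : l * N ≤ 10 * (1 + 4 * δ) * R)
    (hI : 2 * κ * I ≤ 2 * κ * χ * c₀ / l / 2 * D + l * E
      + 1 / (2 * κ * χ * c₀ / l) * (E + δ * N * κ ^ 2)) :
    2 / χ * I ≤ c₀ * D / l + 4 * δ / χ * (20 * (1 + 2 * δ / (χ * c₀))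
      + 10 * (1 + 4 * δ) / (4 * (χ * c₀))) * (H + R) := by
  have hI2 := mul_le_mul_of_nonneg_left hI (show 0 ≤ 1 / (κ * χ) by positivity)
  have e1 : 1 / (κ * χ) * (2 * κ * I) = 2 / χ * I := by field_simp
  have e2 : 1 / (κ * χ) * (2 * κ * χ * c₀ / l / 2 * D + l * E
        + 1 / (2 * κ * χ * c₀ / l) * (E + δ * N * κ ^ 2))
      = c₀ * D / l + (1 / (κ * χ) * (l * E * (1 + 1 / (2 * κ * χ * c₀)))
        + δ * (l * N) / (2 * χ ^ 2 * c₀)) := by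
    field_simp
    ring
  rw [e1, e2] at hI2
  have hκinv : 1 / κ ≤ 4 * δ := by
    rw [div_le_iff₀ hκ]
    linarith
  have b1 : 1 / (κ * χ) ≤ 4 * δ / χ := by
    calc 1 / (κ * χ) = 1 / κ / χ := by rw [div_div]
      _ ≤ 4 * δ / χ := by gcongr
  have b2 : 1 + 1 / (2 * κ * χ * c₀) ≤ 1 + 2 * δ / (χ * c₀) := by
    calc 1 + 1 / (2 * κ * χ * c₀) = 1 + 1 / κ / 2 / (χ * c₀) := by
          field_simp
      _ ≤ 1 + 4 * δ / 2 / (χ * c₀) := by gcongr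
      _ = _ := by ring
  have b3 : 1 / (κ * χ) * (l * E * (1 + 1 / (2 * κ * χ * c₀)))
      ≤ 4 * δ / χ * ((4 * H + 20 * R) * (1 + 2 * δ / (χ * c₀))) := by
    gcongr
  have b4 : δ * (l * N) / (2 * χ ^ 2 * c₀)
      ≤ 4 * δ / χ * (10 * (1 + 4 * δ) / (4 * (χ * c₀)) * R) := by
    calc δ * (l * N) / (2 * χ ^ 2 * c₀) ≤ δ * (10 * (1 + 4 * δ) * R) / (2 * χ ^ 2 * c₀) := by
          gcongr
      _ ≤ 2 * (δ * (10 * (1 + 4 * δ) * R) / (2 * χ ^ 2 * c₀)) := by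
          have : 0 ≤ δ * (10 * (1 + 4 * δ) * R) / (2 * χ ^ 2 * c₀) := by positivity
          linarith
      _ = _ := by
          field_simp
  have e3 : 4 * δ / χ * (20 * (1 + 2 * δ / (χ * c₀))
        + 10 * (1 + 4 * δ) / (4 * (χ * c₀))) * (H + R)
      = 4 * δ / χ * ((4 * H + 20 * R) * (1 + 2 * δ / (χ * c₀)))
        + 4 * δ / χ * (10 * (1 + 4 * δ) / (4 * (χ * c₀)) * R)
        + 4 * δ / χ * (16 * H * (1 + 2 * δ / (χ * c₀))
          + 10 * (1 + 4 * δ) / (4 * (χ * c₀)) * H) := by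
    ring
  have b5 : 0 ≤ 4 * δ / χ * (16 * H * (1 + 2 * δ / (χ * c₀))
      + 10 * (1 + 4 * δ) / (4 * (χ * c₀)) * H) := by
    positivity
  rw [e3]
  linarith

/-- The bound of the entropy production on large tori. The exclusion part of the production
absorbs the Dirichlet form in the bound of the interaction. -/
lemma production_generator_le (hd : 1 ≤ d) (hn : 4 ≤ n) {ρ c₀ a : ℝ} (h0 : 0 < ρ) (h1 : ρ < 1)
    (hc₀ : 0 < c₀) (ha : 1 ≤ a) (hsmall : a / (n : ℝ) ^ 2 ≤ 1 / 64)
    {c : Fin d → LatticeConfig d → ℝ} (hlow : ∀ j η, c₀ ≤ c j η)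
    (hc : ∀ (j : Fin d) (x : Torus d n) (η : Config d n),
      c j (torusShift x (exchange x (x + Pi.single j 1) η)) = c j (torusShift x η))
    {p : Config d n → ℝ} (hp : ∀ η, 0 ≤ p η) (hp1 : ∑ η, p η = 1) :
    production (generator d n c a) (bern d n ρ) p
      ≤ entropyConst d ρ c₀ * a * (ent (bern d n ρ) p + errorTerm d n a) := by
  have hn0 : 0 < (n : ℝ) := natCast_pos'
  have hn4 : (4 : ℝ) ≤ n := by exact_mod_cast hn
  have ha0 : 0 < a := by linarith
  have hd0 : (0 : ℝ) < d := Nat.cast_pos.2 (by omega)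
  have h1' : 0 < 1 - ρ := by linarith
  set χ := ρ * (1 - ρ) with hχ
  have hχ0 : 0 < χ := mul_pos h0 h1'
  set l := a / (n : ℝ) ^ 2 with hl
  have hl0 : 0 < l := by positivity
  set κ := greenStep d n l with hκ
  set G := greenZero d n l with hG
  set N := (n : ℝ) ^ d with hN
  have hN0 : 0 < N := volume_pos
  -- `l G ≤ 1/n + 2 √l`, which the lower bound on `n` and the upper bound on `l` make at most `1/2`;
  -- this keeps the coefficient `κ` of the interaction away from `0`
  have hlG : l * G ≤ 1 / 2 := by
    have h2 := mul_le_mul_of_nonneg_left (greenZero_le_one_dim (n := n) hd hl0) hl0.le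
    have h3 : l * √(1 / l) = √l := by
      rw [Real.sqrt_div zero_le_one, Real.sqrt_one, ← mul_div_assoc, mul_one, Real.div_sqrt]
    have h4 : l * (1 / n / l) = 1 / n := by field_simp
    have h5 : √l ≤ 1 / 8 := Real.sqrt_le_iff.2 ⟨by norm_num, by linarith⟩
    have h6 : (1 : ℝ) / n ≤ 1 / 4 := one_div_le_one_div_of_le (by norm_num) hn4
    linarith
  have hG0 : 0 < G := greenZero_pos hl0
  have hκd : 2 * d * κ = 1 - l * G := by
    rw [hκ, greenStep, ← hG]
    field_simp
  have hκ1 : d * κ ≤ 1 / 2 := by nlinarith [mul_pos hl0 hG0]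
  have hκ2 : 1 ≤ 4 * d * κ := by linarith
  have hκ0 : 0 < κ := by
    by_contra h
    nlinarith [mul_nonneg hd0.le (neg_nonneg.2 (not_lt.1 h))]
  set g : Config d n → ℝ := fun η => √(p η / bern d n ρ η) with hg
  have hgp : ∀ η, bern d n ρ η * g η ^ 2 = p η := fun η => by
    rw [hg, Real.sq_sqrt (div_nonneg (hp η) (bern_pos h0 h1 η).le),
      mul_div_cancel₀ _ (bern_pos h0 h1 η).ne']
  set E := ∑ η, p η * energy l (centered ρ η) with hE
  set H := ent (bern d n ρ) p with hH
  set R := errorTerm d n a with hR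
  have hR0 : 0 ≤ R := errorTerm_nonneg ha0.le
  have hH0 : 0 ≤ H := ent_nonneg (bern_pos h0 h1) (sum_bern ρ) hp hp1
  have hNG : l * N * G ≤ 10 * R := mul_greenZero_le_errorTerm hd (by omega) ha
  have hlE : l * E ≤ 4 * H + 20 * R := by
    have := sum_mul_energy_le h0 h1 hl0 hp hp1
    linarith
  have hlN : l * N ≤ 10 * (1 + 4 * d) * R := by
    have h2 := one_le_mul_greenZero (d := d) (n := n) hl0 (by linarith)
    have h3 := mul_le_mul_of_nonneg_left h2 (mul_nonneg hl0.le hN0.le)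
    have h4 := mul_le_mul_of_nonneg_left hNG (show (0 : ℝ) ≤ 1 + 4 * d by positivity)
    linarith
  have hA : 0 < 2 * κ * χ * c₀ / l := by positivity
  have hI := interaction_le hd hl0 h0 h1 hp1 hgp hA
  have hV := production_voterGen_le (n := n) (by omega) h0 h1 hp
  have hS := production_exclusionGen_le h0 h1 hlow hc p
  rw [production_generator]
  have hfin := mul_le_mul_of_nonneg_left (interaction_le_of_bounds hd0 hχ0 hκ0 hl0 hc₀
    (Finset.sum_nonneg fun η _ => mul_nonneg (hp η) (energy_nonneg hl0 _)) hH0 hR0 hκ2 hlE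
    hlN hI) ha0.le
  have hS' := mul_le_mul_of_nonneg_left hS (sq_nonneg (n : ℝ))
  have hV' := mul_le_mul_of_nonneg_left hV ha0.le
  have hD : a * (c₀ * dirichlet ρ g / l) = (n : ℝ) ^ 2 * (c₀ * dirichlet ρ g) := by
    rw [hl]
    field_simp
  rw [mul_add, hD] at hfin
  rw [entropyConst, ← hχ]
  linarith

/-- On a fixed finite state space the entropy production is bounded. -/
lemma exists_production_le {Ω : Type*} [Fintype Ω] [DecidableEq Ω]
    (L : (Ω → ℝ) →ₗ[ℝ] (Ω → ℝ)) {ν : Ω → ℝ} (hν : ∀ ξ, 0 < ν ξ) :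
    ∃ K : ℝ, 0 ≤ K ∧ ∀ p : Ω → ℝ, (∀ ξ, 0 ≤ p ξ) → ∑ ξ, p ξ = 1 → production L ν p ≤ K := by
  set B : ℝ := ∑ ξ, 1 / ν ξ with hB
  have hB0 : 0 ≤ B := Finset.sum_nonneg fun ξ _ => (one_div_pos.2 (hν ξ)).le
  refine ⟨2 * ∑ ξ, ν ξ * ∑ η, |L (Pi.single η 1) ξ| * B, ?_, fun p hp hp1 => ?_⟩
  · exact mul_nonneg zero_le_two (Finset.sum_nonneg fun ξ _ => mul_nonneg (hν ξ).le
      (Finset.sum_nonneg fun η _ => mul_nonneg (abs_nonneg _) hB0))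
  have hg : ∀ ξ, √(p ξ / ν ξ) ≤ √B := fun ξ => by
    refine Real.sqrt_le_sqrt ?_
    have h1 : p ξ ≤ 1 := by
      rw [← hp1]
      exact Finset.single_le_sum (fun ζ _ => hp ζ) (Finset.mem_univ ξ)
    calc p ξ / ν ξ ≤ 1 / ν ξ := div_le_div_of_nonneg_right h1 (hν ξ).le
      _ ≤ B := Finset.single_le_sum (f := fun ξ => 1 / ν ξ)
        (fun ζ _ => (one_div_pos.2 (hν ζ)).le) (Finset.mem_univ ξ)
  rw [production]
  refine mul_le_mul_of_nonneg_left (Finset.sum_le_sum fun ξ _ =>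
    mul_le_mul_of_nonneg_left ?_ (hν ξ).le) zero_le_two
  rw [linearMap_apply_eq_sum, Finset.mul_sum]
  refine Finset.sum_le_sum fun η _ => ?_
  calc √(p ξ / ν ξ) * (√(p η / ν η) * L (Pi.single η 1) ξ)
      = L (Pi.single η 1) ξ * (√(p ξ / ν ξ) * √(p η / ν η)) := by ring
    _ ≤ |L (Pi.single η 1) ξ| * (√(p ξ / ν ξ) * √(p η / ν η)) :=
        mul_le_mul_of_nonneg_right (le_abs_self _) (by positivity)
    _ ≤ |L (Pi.single η 1) ξ| * (√B * √B) := by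
        exact mul_le_mul_of_nonneg_left (mul_le_mul (hg ξ) (hg η) (Real.sqrt_nonneg _)
          (Real.sqrt_nonneg _)) (abs_nonneg _)
    _ = |L (Pi.single η 1) ξ| * B := by rw [Real.mul_self_sqrt hB0]

lemma errorTerm_pos {n : ℕ} (hn : 2 ≤ n) {a : ℝ} (ha : 0 < a) : 0 < errorTerm d n a := by
  have hn1 : (1 : ℝ) < n := by exact_mod_cast hn
  have := Real.log_pos hn1
  unfold errorTerm
  split_ifs <;> positivity

/-- On a torus with a single site nothing moves. -/
lemma production_generator_one (c : Fin d → LatticeConfig d → ℝ) (a : ℝ) (ν p : Config d 1 → ℝ) :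
    production (generator d 1 c a) ν p = 0 := by
  have h1 : ∀ (x y : Torus d 1) (η : Config d 1), exchange x y η = η := fun x y η =>
    funext fun z => congrArg η (Subsingleton.elim _ _)
  have h2 : ∀ (x y : Torus d 1) (η : Config d 1), occ (η y) - occ (η x) = 0 := fun x y η => by
    rw [Subsingleton.elim x y, sub_self]
  simp [production, generator, exclusionGen, voterGen, h1, h2]

lemma exists_production_generator_le {c : Fin d → LatticeConfig d → ℝ} {a ρ : ℝ} (ha : 0 < a)
    (h0 : 0 < ρ) (h1 : ρ < 1) : ∃ C : ℝ, 0 ≤ C ∧ ∀ p : Config d n → ℝ, (∀ ξ, 0 ≤ p ξ) →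
      ∑ ξ, p ξ = 1 → production (generator d n c a) (bern d n ρ) p
        ≤ C * a * (ent (bern d n ρ) p + errorTerm d n a) := by
  have hn : n = 1 ∨ 2 ≤ n := by
    have := NeZero.pos n
    omega
  rcases hn with rfl | hn
  · exact ⟨0, le_rfl, fun p _ _ => by simp [production_generator_one]⟩
  · obtain ⟨K, hK0, hK⟩ := exists_production_le (generator d n c a) (bern_pos (n := n) h0 h1)
    have hR := errorTerm_pos (d := d) hn ha
    refine ⟨K / (a * errorTerm d n a), by positivity, fun p hp hp1 => (hK p hp hp1).trans ?_⟩
    have hH := ent_nonneg (bern_pos h0 h1) (sum_bern ρ) hp hp1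
    have e : K / (a * errorTerm d n a) * a * (ent (bern d n ρ) p + errorTerm d n a)
        = K + K / errorTerm d n a * ent (bern d n ρ) p := by
      field_simp
      ring
    rw [e]
    have : 0 ≤ K / errorTerm d n a * ent (bern d n ρ) p := by positivity
    linarith

end Final

end VoterStirring
end

theorem theorem2p3 (d : ℕ) (hd : 1 ≤ d) (ρ : ℝ) (hρ₀ : 0 < ρ) (hρ₁ : ρ < 1)
    (c₀ : ℝ) (hc₀ : 0 < c₀) :
    ∃ C₀ : ℝ, 0 < C₀ ∧
      ∀ c : Fin d → VoterStirring.LatticeConfig d → ℝ, VoterStirring.IsGradientRates c₀ c →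
      ∀ a : ℕ → ℝ, (∀ n, 1 ≤ n → 0 < a n) → Tendsto a atTop atTop →
        Tendsto (fun n : ℕ => a n / (n : ℝ) ^ 2) atTop (𝓝 0) →
      (∃ n₀ : ℕ, ∀ (n : ℕ) [NeZero n], n₀ ≤ n →
        ∀ (μ : Measure (VoterStirring.Config d n)) [IsProbabilityMeasure μ],
          VoterStirring.EntropyBound c (a n) ρ μ C₀) ∧
      (∃ C₁ : ℝ, 0 < C₁ ∧ ∀ (n : ℕ) [NeZero n]
        (μ : Measure (VoterStirring.Config d n)) [IsProbabilityMeasure μ],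
          VoterStirring.EntropyBound c (a n) ρ μ C₁) := by
  open VoterStirring in
  have hC := entropyConst_pos hd hρ₀ hρ₁ hc₀
  refine ⟨entropyConst d ρ c₀, hC, fun c hc a hapos ha hasq => ?_⟩
  have hcnn : ∀ j η, 0 ≤ c j η := fun j η => hc₀.le.trans (hc.lower j η)
  obtain ⟨n₁, hn₁⟩ := exists_forall_rate_exchange hc
  obtain ⟨n₂, hn₂⟩ := eventually_atTop.1 (ha.eventually_ge_atTop 1)
  obtain ⟨n₃, hn₃⟩ := eventually_atTop.1
    (hasq.eventually (ge_mem_nhds (show (0 : ℝ) < 1 / 64 by norm_num)))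
  set n₀ := max (max n₁ n₂) (max n₃ 4) with hn₀
  have hlarge : ∀ (n : ℕ) [NeZero n], n₀ ≤ n → ∀ p : Config d n → ℝ, (∀ ξ, 0 ≤ p ξ) →
      ∑ ξ, p ξ = 1 → production (generator d n c (a n)) (bern d n ρ) p
        ≤ entropyConst d ρ c₀ * a n * (ent (bern d n ρ) p + errorTerm d n (a n)) :=
    fun n _ hn p hp hp1 => by
      simp only [hn₀, max_le_iff] at hn
      exact production_generator_le hd hn.2.2 hρ₀ hρ₁ hc₀ (hn₂ n hn.1.2) (hn₃ n hn.2.1) hc.lower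
        (hn₁ n hn.1.1) hp hp1
  refine ⟨⟨n₀, fun n _ hn μ _ => entropyBound_of_production hcnn (hapos n NeZero.one_le).le hρ₀ hρ₁
    (hlarge n hn) μ⟩, ?_⟩
  have hsmall : ∀ m : ℕ, ∃ C : ℝ, 0 ≤ C ∧ ∀ p : Config d (m + 1) → ℝ, (∀ ξ, 0 ≤ p ξ) →
      ∑ ξ, p ξ = 1 → production (generator d (m + 1) c (a (m + 1))) (bern d (m + 1) ρ) p
        ≤ C * a (m + 1) * (ent (bern d (m + 1) ρ) p + errorTerm d (m + 1) (a (m + 1))) :=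
    fun m => exists_production_generator_le (hapos (m + 1) (by omega)) hρ₀ hρ₁
  choose Cs hCs0 hCs using hsmall
  -- `C₁` is the sum of the constant for large tori and those of the finitely many small tori
  have hsum0 : 0 ≤ ∑ m ∈ Finset.range n₀, Cs m := Finset.sum_nonneg fun m _ => hCs0 m
  refine ⟨entropyConst d ρ c₀ + ∑ m ∈ Finset.range n₀, Cs m, by linarith, fun n _ μ _ =>
    entropyBound_of_production hcnn (hapos n NeZero.one_le).le hρ₀ hρ₁ (fun p hp hp1 => ?_) μ⟩
  have han := hapos n NeZero.one_le
  have hHR : 0 ≤ ent (bern d n ρ) p + errorTerm d n (a n) :=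
    add_nonneg (ent_nonneg (bern_pos hρ₀ hρ₁) (sum_bern ρ) hp hp1) (errorTerm_nonneg han.le)
  have hmono : ∀ C C' : ℝ, C ≤ C' → C * a n * (ent (bern d n ρ) p + errorTerm d n (a n))
      ≤ C' * a n * (ent (bern d n ρ) p + errorTerm d n (a n)) := fun C C' h =>
    mul_le_mul_of_nonneg_right (mul_le_mul_of_nonneg_right h han.le) hHR
  rcases le_or_gt n₀ n with hn | hn
  · exact (hlarge n hn p hp hp1).trans (hmono _ _ (by linarith))
  · obtain ⟨m, rfl⟩ := Nat.exists_eq_succ_of_ne_zero (NeZero.ne n)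
    refine (hCs m p hp hp1).trans (hmono _ _ ?_)
    have := Finset.single_le_sum (f := Cs) (fun m _ => hCs0 m)
      (Finset.mem_range.2 (show m < n₀ by omega))
    linarith
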